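/- Let $(R,\mathfrak m)$ be a commutative Noetherian local ring, $\mathfrak a$ an ideal of $R$ and $M$ an (arbitrary) $R$-module. Write $H^i_{\mathfrak a}(M)=\varinjlim_n \operatorname{Ext}^i_R(R/\mathfrak a^n,M)$ for the $i$-th local cohomology module. All infima and suprema below are taken over integers $i\ge 0$ (resp. lengths) in $\mathbb N_0\cup\{\infty\}$, with $\inf\emptyset=\infty$. For ideals $\mathfrak b,\mathfrak c$ of $R$ put $$f_{\mathfrak b}(M)=\inf\{i: H^i_{\mathfrak b}(M)\text{ is not finitely generated}\},\qquad f_{\mathfrak b}^{\mathfrak c}(M)=\inf\{i:\mathfrak c\nsubseteq\operatorname{rad}(\operatorname{Ann}_R H^i_{\mathfrak b}(M))\},$$ $$\operatorname{grade}(\mathfrak b,M)=\inf\{i:\operatorname{Ext}^i_R(R/\mathfrak b,M)\neq 0\},\qquad \operatorname{depth}M=\operatorname{grade}(\mathfrak m,M).$$ A sequence $x_1,\dots,x_n$ of elements of $\mathfrak a$ is an $M$-filter regular sequence in $\mathfrak a$ if $x_i\notin\mathfrak p$ for all $1\le i\le n$ and all $\mathfrak p\in\operatorname{Ass}_R(M/(x_1,\dots,x_{i-1})M)\setminus\{\mathfrak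 m\}$; it is maximal if there is no $y\in\mathfrak a$ such that $x_1,\dots,x_n,y$ is again $M$-filter regular. For finitely generated $M$, $\operatorname{f-depth}(\mathfrak a,M)$ is the supremum of the lengths of the $M$-filter regular sequences in $\mathfrak a$ (equivalently, the length of any maximal one, and $\infty$ if there is no maximal one). **Theorem 2.5.** (i) Assume that $r:=f_{\mathfrak a}^{\mathfrak a}(M)<f_{\mathfrak m}^{\mathfrak a}(M)$. Then $H^r_{\mathfrak a}(M)$ is not Artinian. If moreover $M$ is finitely generated, then $\operatorname{f-depth}(\mathfrak a,M)\le f_{\mathfrak a}(M)$. (ii) Assume that $r:=\operatorname{grade}(\mathfrak a,M)<\operatorname{depth}M$. Then $H^r_{\mathfrak a}(M)$ is not Artinian. If moreover $M$ is finitely generated, then $\operatorname{grade}(\mathfrak a,M)=\operatorname{f-depth}(\mathfrak a,M)$, and every maximal $M$-filter regular sequence in $\mathfrak a$ has length $\operatorname{grade}(\mathfrak a,M)$. -/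

import Mathlib

open CategoryTheory

universe u

noncomputable section

/-- The `i`-th local cohomology module `H^i_𝔞(M)`, i.e. the direct limit over `n` of
`Ext^i_R(R/𝔞^n, M)`. -/
abbrev LocalCohomologyModule {R : Type u} [CommRing R] (𝔞 : Ideal R) (i : ℕ)
    (M : Type u) [AddCommGroup M] [Module R M] : ModuleCat.{u} R :=
  (localCohomology 𝔞 i).obj (ModuleCat.of R M)

/-- The module `Ext^i_R(N, M)`. -/
abbrev ExtModule (R : Type u) [CommRing R] (i : ℕ) (N M : Type u)
    [AddCommGroup N] [Module R N] [AddCommGroup M] [Module R M] : ModuleCat.{u} R :=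
  ((Ext R (ModuleCat.{u} R) i).obj (Opposite.op (ModuleCat.of R N))).obj (ModuleCat.of R M)

/-- `grade(𝔞, M) = inf {i : Ext^i_R(R/𝔞, M) ≠ 0}`, with value `⊤` if there is no such `i`.
The module `M` need not be finitely generated. -/
def moduleGrade {R : Type u} [CommRing R] (𝔞 : Ideal R)
    (M : Type u) [AddCommGroup M] [Module R M] : ℕ∞ :=
  ⨅ (i : ℕ) (_ : Nontrivial (ExtModule R i (R ⧸ 𝔞) M)), (i : ℕ∞)

/-- The depth of a module over a local ring `(R, 𝔪)`, i.e. `grade(𝔪, M)`. -/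
def moduleDepth (R : Type u) [CommRing R] [IsLocalRing R]
    (M : Type u) [AddCommGroup M] [Module R M] : ℕ∞ :=
  moduleGrade (IsLocalRing.maximalIdeal R) M

/-- `f_𝔞(M)`, the least `i` such that `H^i_𝔞(M)` is not finitely generated (`⊤` if none). -/
def finitenessDim {R : Type u} [CommRing R] (𝔞 : Ideal R)
    (M : Type u) [AddCommGroup M] [Module R M] : ℕ∞ :=
  ⨅ (i : ℕ) (_ : ¬ Module.Finite R (LocalCohomologyModule 𝔞 i M)), (i : ℕ∞)

/-- `f_𝔞^𝔟(M)`, the least `i` such that `𝔟 ⊄ rad (Ann H^i_𝔞(M))` (`⊤` if none). The first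
argument `𝔞` is the lower index (support of the local cohomology), the second argument `𝔟`
is the upper index. -/
def relFinitenessDim {R : Type u} [CommRing R] (𝔞 𝔟 : Ideal R)
    (M : Type u) [AddCommGroup M] [Module R M] : ℕ∞ :=
  ⨅ (i : ℕ) (_ : ¬ 𝔟 ≤ (Module.annihilator R (LocalCohomologyModule 𝔞 i M)).radical), (i : ℕ∞)

/-- `xs = [x₁, …, xₙ]` is an `M`-filter regular sequence with all entries in `𝔞`: each `xᵢ` is
outside every associated prime of `M / (x₁, …, xᵢ₋₁) M` other than the maximal ideal. -/
structure IsFilterRegularIn {R : Type u} [CommRing R] [IsLocalRing R] (𝔞 : Ideal R)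
    (M : Type u) [AddCommGroup M] [Module R M] (xs : List R) : Prop where
  mem : ∀ x ∈ xs, x ∈ 𝔞
  notMem_prime : ∀ (i : ℕ) (h : i < xs.length),
    ∀ p ∈ associatedPrimes R (M ⧸ (Ideal.ofList (xs.take i) • ⊤ : Submodule R M)),
      p ≠ IsLocalRing.maximalIdeal R → xs[i] ∉ p

/-- A maximal `M`-filter regular sequence in `𝔞`: one that cannot be extended by an element
of `𝔞`. -/
def IsMaximalFilterRegularIn {R : Type u} [CommRing R] [IsLocalRing R] (𝔞 : Ideal R)
    (M : Type u) [AddCommGroup M] [Module R M] (xs : List R) : Prop :=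
  IsFilterRegularIn 𝔞 M xs ∧ ∀ y : R, ¬ IsFilterRegularIn 𝔞 M (xs ++ [y])

/-- The filter depth `f-depth(𝔞, M)`: the supremum of the lengths of the `M`-filter regular
sequences in `𝔞`. For finitely generated `M` over a Noetherian local ring this is the length of
any maximal one, and it is `⊤` when there are no maximal ones. -/
def filterDepth {R : Type u} [CommRing R] [IsLocalRing R] (𝔞 : Ideal R)
    (M : Type u) [AddCommGroup M] [Module R M] : ℕ∞ :=
  ⨆ (xs : List R) (_ : IsFilterRegularIn 𝔞 M xs), (xs.length : ℕ∞)

end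

/-!
Local cohomology and `Ext` of cyclic modules are computed inside one complex `E` of injective
modules: `H^i_𝔟(M)` is the cohomology of the subcomplex `Γ_𝔟(E)` of the elements killed by some
power of `𝔟`, and `Ext^i(R/𝔟, M)` that of the subcomplex `(0 :_E 𝔟)` (`exists_injective_complex`).
After this everything is a computation with cocycles and coboundaries, which takes the place of
spectral sequences.

*Non-Artinian modules.* Let `𝔞 ≤ 𝔪`, let powers of `c` kill `H^i_𝔞(M)` for `i < r` and also
`H^r_𝔪(M)`, and let `H^r_𝔞(M)` be `𝔪`-torsion, as it is when it is Artinian. Passing from `𝔟` to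
`𝔟 + (x)` with `x ∈ 𝔪`, injective modules being divisible by `x` up to bounded `x`-torsion, the map
`H^r_{𝔟 + (x)} → H^r_𝔞` remains an isomorphism up to powers of `c`. After finitely many steps the
ideal is `𝔪`, so a power of `c` kills `H^r_𝔞(M)` (`mem_radical_annihilator_localCohomology`). For
`c ∈ 𝔞` and `r = f_𝔞^𝔞(M)` this contradicts the choice of `r`. For `c = 1` and `r = grade(𝔞, M)` it
gives `H^i_𝔞(M) = 0` for all `i ≤ r`, hence `Ext^r(R/𝔞, M) = 0`, again a contradiction.

*Filter regular sequences.* Multiplication by a filter regular element has an `𝔪`-torsion kernel,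
so that an `M`-filter regular sequence in `𝔞` of length `n` makes `H^i_𝔞(M)` an `𝔪`-torsion module
for `i < n` (`exists_pow_smul_localCohomology_eq_zero`). By the first part `n ≤ r`, in both
situations. For `r = f_𝔞^𝔞(M)` it remains to see that `H^i_𝔞(M)` is finitely generated for `i < r`:
it is killed by a power of `𝔞`, and is then a quotient of some `Ext^i(R/𝔟, M)`
(`finite_localCohomology_of_le_radical_annihilator`). For `r = grade(𝔞, M) < depth M`, a filter
regular sequence of length `n < r` is `M`-regular, because `Ext^i(R/𝔪, M) = 0` for `i < r`, and it
is extended by a regular element in `𝔞`, because `Ext^n(R/𝔞, M) = 0`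
(`exists_isFilterRegularIn_append`).
-/

/-! ### Power torsion and injective modules -/

/-- The submodule `Γ_𝔞(E)` of the elements of `E` killed by some power of `𝔞`. -/
def powTorsion {R : Type u} [CommRing R] (𝔞 : Ideal R) (E : Type u) [AddCommGroup E]
    [Module R E] : Submodule R E where
  carrier := {w | ∃ n, w ∈ Submodule.torsionBySet R E (𝔞 ^ n : Ideal R)}
  add_mem' := by
    rintro v w ⟨m, hm⟩ ⟨n, hn⟩
    refine ⟨max m n, add_mem ?_ ?_⟩
    · exact Submodule.torsionBySet_le_torsionBySet_of_subset
        (Ideal.pow_le_pow_right (le_max_left m n)) hm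
    · exact Submodule.torsionBySet_le_torsionBySet_of_subset
        (Ideal.pow_le_pow_right (le_max_right m n)) hn
  zero_mem' := ⟨0, zero_mem _⟩
  smul_mem' := fun c _ ⟨n, hn⟩ => ⟨n, Submodule.smul_mem _ c hn⟩

section Torsion

variable {R : Type u} [CommRing R] {E : Type u} [AddCommGroup E] [Module R E]

lemma mem_torsionBySet_ideal {𝔟 : Ideal R} {w : E} :
    w ∈ Submodule.torsionBySet R E (𝔟 : Set R) ↔ ∀ c ∈ 𝔟, c • w = 0 := by
  simp [Submodule.mem_torsionBySet_iff]

lemma torsionBySet_anti {𝔟 𝔠 : Ideal R} (h : 𝔟 ≤ 𝔠) :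
    Submodule.torsionBySet R E (𝔠 : Set R) ≤ Submodule.torsionBySet R E (𝔟 : Set R) :=
  Submodule.torsionBySet_le_torsionBySet_of_subset h

lemma torsionBySet_pow_le_powTorsion (𝔞 : Ideal R) (n : ℕ) :
    Submodule.torsionBySet R E (𝔞 ^ n : Ideal R) ≤ powTorsion 𝔞 E := fun _ h => ⟨n, h⟩

lemma powTorsion_anti {𝔟 𝔠 : Ideal R} (h : 𝔟 ≤ 𝔠) : powTorsion 𝔠 E ≤ powTorsion 𝔟 E :=
  fun _ ⟨n, hn⟩ => ⟨n, torsionBySet_anti (Ideal.pow_right_mono h n) hn⟩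

lemma exists_pow_smul_eq_zero_of_mem_powTorsion {𝔞 : Ideal R} {x : R} (hx : x ∈ 𝔞) {w : E}
    (hw : w ∈ powTorsion 𝔞 E) : ∃ n, x ^ n • w = 0 := by
  obtain ⟨n, hn⟩ := hw
  exact ⟨n, mem_torsionBySet_ideal.1 hn _ (Ideal.pow_mem_pow hx n)⟩

lemma mem_powTorsion_sup_span_singleton {𝔟 : Ideal R} {x : R} {w : E} :
    w ∈ powTorsion (𝔟 ⊔ Ideal.span {x}) E ↔ w ∈ powTorsion 𝔟 E ∧ ∃ n, x ^ n • w = 0 := by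
  refine ⟨fun h => ⟨powTorsion_anti le_sup_left h,
    exists_pow_smul_eq_zero_of_mem_powTorsion
      (Ideal.mem_sup_right (Ideal.mem_span_singleton_self x)) h⟩, ?_⟩
  rintro ⟨⟨m, hm⟩, n, hn⟩
  refine ⟨m + n, mem_torsionBySet_ideal.2 fun c hc => ?_⟩
  have h := Ideal.sup_pow_add_le_pow_sup_pow (I := 𝔟) (J := Ideal.span {x}) (n := m) (m := n) hc
  obtain ⟨s, hs, t, ht, rfl⟩ := Submodule.mem_sup.1 h
  rw [Ideal.span_singleton_pow, Ideal.mem_span_singleton'] at ht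
  obtain ⟨t, rfl⟩ := ht
  rw [add_smul, mem_torsionBySet_ideal.1 hm s hs, mul_smul, hn, smul_zero, add_zero]

lemma exists_le_torsionBySet_pow_of_fg {𝔞 : Ideal R} {N : Submodule R E} (hN : N.FG)
    (h : N ≤ powTorsion 𝔞 E) : ∃ n, N ≤ Submodule.torsionBySet R E (𝔞 ^ n : Ideal R) := by
  obtain ⟨S, rfl⟩ := hN
  have h' : ∀ w ∈ S, ∃ n, w ∈ Submodule.torsionBySet R E (𝔞 ^ n : Ideal R) :=
    fun w hw => h (Submodule.subset_span hw)
  choose! n hn using h'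
  refine ⟨S.sup n, Submodule.span_le.2 fun w hw => ?_⟩
  exact torsionBySet_anti (Ideal.pow_le_pow_right (Finset.le_sup (f := n) hw)) (hn w hw)

variable [IsNoetherianRing R]

/-- Over a Noetherian ring `Γ_𝔞` preserves injectivity. By Artin–Rees a map from an ideal `𝔠` to
`Γ_𝔞(E)` factors through the image of `𝔠` in some `R ⧸ 𝔞 ^ m`, and any extension to `R ⧸ 𝔞 ^ m`
takes values in `Γ_𝔞(E)`. -/
lemma injective_powTorsion (𝔞 : Ideal R) (hE : Module.Injective R E) :
    Module.Injective R (powTorsion 𝔞 E) := by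
  refine Module.Baer.injective fun 𝔠 f => ?_
  let f' : 𝔠 →ₗ[R] E := (powTorsion 𝔞 E).subtype ∘ₗ f
  obtain ⟨n, hn⟩ := exists_le_torsionBySet_pow_of_fg (𝔞 := 𝔞) (N := LinearMap.range f')
    (by rw [LinearMap.range_eq_map]; exact Module.Finite.fg_top.map f')
    (by rintro _ ⟨x, rfl⟩; exact (f x).2)
  obtain ⟨k, hk⟩ := Ideal.exists_pow_inf_eq_pow_smul 𝔞 𝔠
  have hker : Submodule.comap 𝔠.subtype (𝔞 ^ (n + k)) ≤ LinearMap.ker f' := by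
    rintro ⟨c, hc⟩ (hc' : c ∈ 𝔞 ^ (n + k))
    have h1 : c ∈ 𝔞 ^ n • 𝔠 := by
      have : c ∈ 𝔞 ^ (n + k) • (⊤ : Submodule R R) ⊓ 𝔠 := ⟨by simpa using hc', hc⟩
      rw [hk _ (Nat.le_add_left k n), Nat.add_sub_cancel] at this
      exact Submodule.smul_mono le_rfl inf_le_right this
    have h2 : (⟨c, hc⟩ : 𝔠) ∈ 𝔞 ^ n • (⊤ : Submodule R 𝔠) := by
      have : c ∈ Submodule.map 𝔠.subtype (𝔞 ^ n • (⊤ : Submodule R 𝔠)) := by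
        rw [Submodule.map_smul'']; simpa using h1
      obtain ⟨y, hy, rfl⟩ := this
      exact hy
    rw [LinearMap.mem_ker]
    refine Submodule.smul_induction_on h2 (fun s hs y _ => ?_) (fun y z hy hz => ?_)
    · rw [map_smul]; exact mem_torsionBySet_ideal.1 (hn ⟨y, rfl⟩) s hs
    · rw [map_add, hy, hz, add_zero]
  let i : (𝔠 ⧸ Submodule.comap 𝔠.subtype (𝔞 ^ (n + k))) →ₗ[R] R ⧸ (𝔞 ^ (n + k)) :=
    Submodule.mapQ _ _ 𝔠.subtype le_rfl
  have hi : Function.Injective i := by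
    rw [← LinearMap.ker_eq_bot]
    exact Submodule.ker_liftQ_eq_bot _ _ _ (by simp [LinearMap.ker_comp])
  obtain ⟨h, hh⟩ := hE.out i hi (Submodule.liftQ _ f' hker)
  have hw : h (Submodule.Quotient.mk 1) ∈ powTorsion 𝔞 E := by
    refine ⟨n + k, mem_torsionBySet_ideal.2 fun c hc => ?_⟩
    rw [← map_smul, ← Submodule.Quotient.mk_smul, smul_eq_mul, mul_one,
      (Submodule.Quotient.mk_eq_zero _).2 hc, map_zero]
  refine ⟨LinearMap.toSpanSingleton R _ ⟨_, hw⟩, fun c hc => Subtype.ext ?_⟩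
  have := hh (Submodule.Quotient.mk ⟨c, hc⟩)
  simp only [Submodule.liftQ_apply, Submodule.mapQ_apply, i] at this
  change c • h _ = f' ⟨c, hc⟩
  rw [← this, ← map_smul, ← Submodule.Quotient.mk_smul]
  simp

/-- `K` is divisible by `x` up to `x ^ e`-torsion. -/
def AlmostDivisible (x : R) (e : ℕ) (K : Submodule R E) : Prop :=
  ∀ n, ∀ w ∈ K, ∃ w' ∈ K, x ^ (n + e) • w' = x ^ e • w


end Torsion

section Divisible

variable {R : Type u} [CommRing R] [IsNoetherianRing R]

/-- The exponent is one at which the chain of ideals `(𝔟 : x ^ e)` is stationary; in particular it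
does not depend on the injective module. -/
lemma exists_almostDivisible_torsionBySet (𝔟 : Ideal R) (x : R) :
    ∃ e, ∀ (E : Type u) [AddCommGroup E] [Module R E], Module.Injective R E →
      AlmostDivisible x e (Submodule.torsionBySet R E (𝔟 : Set R)) := by
  let col : ℕ →o Ideal R :=
    { toFun := fun e => Submodule.comap (LinearMap.lsmul R R (x ^ e)) 𝔟
      monotone' := monotone_nat_of_le_succ fun n s hs => by
        simp only [Submodule.mem_comap, LinearMap.lsmul_apply, smul_eq_mul] at hs ⊢
        rw [pow_succ', mul_assoc]
        exact 𝔟.mul_mem_left _ hs }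
  obtain ⟨e, he⟩ := monotone_stabilizes_iff_noetherian.2 ‹IsNoetherianRing R› col
  refine ⟨e, fun E _ _ hE n w hw => ?_⟩
  let i : (R ⧸ col (n + e)) →ₗ[R] R ⧸ 𝔟 :=
    Submodule.mapQ _ _ (LinearMap.lsmul R R (x ^ (n + e))) le_rfl
  have hi : Function.Injective i := by
    rw [← LinearMap.ker_eq_bot]
    exact Submodule.ker_liftQ_eq_bot _ _ _ (by simp [LinearMap.ker_comp, col])
  have hg : col (n + e) ≤ LinearMap.ker (LinearMap.toSpanSingleton R E (x ^ e • w)) := by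
    rw [← he _ (Nat.le_add_left e n)]
    intro s hs
    rw [LinearMap.mem_ker, LinearMap.toSpanSingleton_apply, smul_smul, mul_comm]
    exact mem_torsionBySet_ideal.1 hw _ hs
  obtain ⟨h, hh⟩ := hE.out i hi (Submodule.liftQ _ _ hg)
  refine ⟨h (Submodule.Quotient.mk 1), mem_torsionBySet_ideal.2 fun c hc => ?_, ?_⟩
  · rw [← map_smul, ← Submodule.Quotient.mk_smul, smul_eq_mul, mul_one,
      (Submodule.Quotient.mk_eq_zero _).2 hc, map_zero]
  · have := hh (Submodule.Quotient.mk 1)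
    simp only [Submodule.liftQ_apply, Submodule.mapQ_apply, i, LinearMap.lsmul_apply,
      LinearMap.toSpanSingleton_apply, one_smul] at this
    rw [← this, ← map_smul, ← Submodule.Quotient.mk_smul]

lemma exists_almostDivisible_powTorsion_inf (𝔞 𝔟 : Ideal R) (x : R) :
    ∃ e, ∀ (E : Type u) [AddCommGroup E] [Module R E], Module.Injective R E →
      AlmostDivisible x e (powTorsion 𝔞 E ⊓ Submodule.torsionBySet R E (𝔟 : Set R)) := by
  obtain ⟨e, he⟩ := exists_almostDivisible_torsionBySet 𝔟 x
  refine ⟨e, fun E _ _ hE n w hw => ?_⟩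
  obtain ⟨w', hw', h⟩ := he _ (injective_powTorsion 𝔞 hE) n ⟨w, hw.1⟩
    (mem_torsionBySet_ideal.2 fun c hc => Subtype.ext (mem_torsionBySet_ideal.1 hw.2 c hc))
  exact ⟨w', ⟨w'.2, mem_torsionBySet_ideal.2 fun c hc =>
    congrArg Subtype.val (mem_torsionBySet_ideal.1 hw' c hc)⟩, congrArg Subtype.val h⟩

lemma exists_almostDivisible_powTorsion (𝔞 : Ideal R) (x : R) :
    ∃ e, ∀ (E : Type u) [AddCommGroup E] [Module R E], Module.Injective R E →
      AlmostDivisible x e (powTorsion 𝔞 E) := by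
  obtain ⟨e, he⟩ := exists_almostDivisible_powTorsion_inf 𝔞 ⊥ x
  refine ⟨e, fun E _ _ hE => ?_⟩
  have : Submodule.torsionBySet R E ((⊥ : Ideal R) : Set R) = ⊤ :=
    eq_top_iff.2 fun w _ => mem_torsionBySet_ideal.2 fun c hc => by
      rw [Ideal.mem_bot.1 hc, zero_smul]
  simpa only [this, inf_top_eq] using he E hE

end Divisible

/-! ### Cohomology of subcomplexes -/

section Complex

variable {R : Type u} [CommRing R] {E : ℕ → Type u} [∀ i, AddCommGroup (E i)]
  [∀ i, Module R (E i)] (d : ∀ i, E i →ₗ[R] E (i + 1))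

/-- The coboundaries of the graded submodule `K` of `(E, d)`, in each degree. -/
def coboundaries (K : ∀ i, Submodule R (E i)) : ∀ i, Submodule R (E i)
  | 0 => ⊥
  | i + 1 => (K i).map (d i)

/-- The cocycles of the graded submodule `K` of `(E, d)`, in degree `i`. -/
def cocycles (K : ∀ i, Submodule R (E i)) (i : ℕ) : Submodule R (E i) :=
  K i ⊓ LinearMap.ker (d i)

/-- The cohomology in degree `i` of the graded submodule `K` of `(E, d)`. It is defined for any
graded submodule, but it has a meaning only for subcomplexes. -/
abbrev Cohomology (K : ∀ i, Submodule R (E i)) (i : ℕ) : Type u :=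
  cocycles d K i ⧸ (coboundaries d K i).submoduleOf (cocycles d K i)

/-- The subcomplex `Γ_𝔞(E)`. -/
abbrev powTorsionComplex (E : ℕ → Type u) [∀ i, AddCommGroup (E i)] [∀ i, Module R (E i)]
    (𝔞 : Ideal R) (i : ℕ) : Submodule R (E i) := powTorsion 𝔞 (E i)

/-- The subcomplex `(0 :_E 𝔟)`, that is `Hom(R ⧸ 𝔟, E)`. -/
abbrev torsionByComplex (E : ℕ → Type u) [∀ i, AddCommGroup (E i)] [∀ i, Module R (E i)]
    (𝔟 : Ideal R) (i : ℕ) : Submodule R (E i) := Submodule.torsionBySet R (E i) (𝔟 : Set R)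

variable {d} {K L : ∀ i, Submodule R (E i)} {i : ℕ}

lemma mk_eq_zero_iff_mem_coboundaries {z : E i} (hz : z ∈ cocycles d K i) :
    (Submodule.Quotient.mk ⟨z, hz⟩ : Cohomology d K i) = 0 ↔ z ∈ coboundaries d K i := by
  rw [Submodule.Quotient.mk_eq_zero]; rfl

lemma coboundaries_mono (h : ∀ i, K i ≤ L i) (i : ℕ) :
    coboundaries d K i ≤ coboundaries d L i := by
  cases i with
  | zero => exact le_rfl
  | succ i => exact Submodule.map_mono (h i)

lemma cocycles_mono (h : ∀ i, K i ≤ L i) (i : ℕ) : cocycles d K i ≤ cocycles d L i :=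
  inf_le_inf_right _ (h i)

/-- The map on cohomology induced by an inclusion of graded submodules. -/
def cohomologyMap (h : ∀ i, K i ≤ L i) (i : ℕ) : Cohomology d K i →ₗ[R] Cohomology d L i :=
  Submodule.mapQ _ _ (Submodule.inclusion (cocycles_mono h i))
    fun _ hz => coboundaries_mono h i hz

lemma cohomologyMap_mk (h : ∀ i, K i ≤ L i) {z : E i} (hz : z ∈ cocycles d K i) :
    cohomologyMap h i (Submodule.Quotient.mk ⟨z, hz⟩) =
      Submodule.Quotient.mk ⟨z, cocycles_mono h i hz⟩ := rfl

lemma map_mem_powTorsion {M N : Type u} [AddCommGroup M] [Module R M] [AddCommGroup N]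
    [Module R N] (f : M →ₗ[R] N) {𝔞 : Ideal R} {w : M} (hw : w ∈ powTorsion 𝔞 M) :
    f w ∈ powTorsion 𝔞 N := by
  obtain ⟨n, hn⟩ := hw
  refine ⟨n, mem_torsionBySet_ideal.2 fun c hc => ?_⟩
  rw [← map_smul, mem_torsionBySet_ideal.1 hn c hc, map_zero]

lemma map_mem_torsionBySet {M N : Type u} [AddCommGroup M] [Module R M] [AddCommGroup N]
    [Module R N] (f : M →ₗ[R] N) {𝔟 : Ideal R} {w : M}
    (hw : w ∈ Submodule.torsionBySet R M (𝔟 : Set R)) :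
    f w ∈ Submodule.torsionBySet R N (𝔟 : Set R) :=
  mem_torsionBySet_ideal.2 fun c hc => by
    rw [← map_smul, mem_torsionBySet_ideal.1 hw c hc, map_zero]

lemma map_eq_zero_of_mem_coboundaries (hd : ∀ i w, d (i + 1) (d i w) = 0) {z : E i}
    (hz : z ∈ coboundaries d K i) : d i z = 0 := by
  cases i with
  | zero => rw [(Submodule.mem_bot R).1 hz, map_zero]
  | succ i => obtain ⟨w, -, rfl⟩ := hz; exact hd i w

lemma coboundaries_le_cocycles (hd : ∀ i w, d (i + 1) (d i w) = 0)
    (hK : ∀ i, ∀ w ∈ K i, d i w ∈ K (i + 1)) (i : ℕ) :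
    coboundaries d K i ≤ cocycles d K i := by
  refine fun z hz => ⟨?_, map_eq_zero_of_mem_coboundaries hd hz⟩
  cases i with
  | zero => rw [(Submodule.mem_bot R).1 hz]; exact zero_mem _
  | succ i => obtain ⟨w, hw, rfl⟩ := hz; exact hK i w hw

/-- If a multiple of `y` by a power of `x` is a coboundary, then `y` agrees with a coboundary up
to `x`-power torsion. -/
lemma exists_coboundary_smul_sub_eq_zero {x : R} {e : ℕ}
    (hdiv : ∀ i, AlmostDivisible x e (K i)) {n : ℕ} {y : E i}
    (hy : x ^ n • y ∈ coboundaries d K i) :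
    ∃ y' ∈ coboundaries d K i, x ^ (n + e) • (y - y') = 0 := by
  cases i with
  | zero =>
    refine ⟨0, zero_mem _, ?_⟩
    rw [sub_zero, add_comm, pow_add, mul_smul, (Submodule.mem_bot R).1 hy, smul_zero]
  | succ i =>
    obtain ⟨w, hw, hwy⟩ := hy
    obtain ⟨w', hw', h⟩ := hdiv i n w hw
    refine ⟨d i w', ⟨w', hw', rfl⟩, ?_⟩
    rw [smul_sub, ← map_smul, h, map_smul, hwy, smul_smul, ← pow_add, add_comm e n, sub_self]

end Complex

/-! ### Enlarging the ideal of the support by one element -/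

section Enlarge

variable {R : Type u} [CommRing R] [IsNoetherianRing R] {E : ℕ → Type u}
  [∀ i, AddCommGroup (E i)] [∀ i, Module R (E i)] {d : ∀ i, E i →ₗ[R] E (i + 1)}
  (hd : ∀ i w, d (i + 1) (d i w) = 0) (hE : ∀ i, Module.Injective R (E i))

include hd hE

/-- An `x`-power torsion class of `H^i_𝔟` comes from `H^i_{𝔟 + (x)}`. -/
lemma exists_cocycle_sub_mem_coboundaries {𝔟 : Ideal R} {x : R} {i n : ℕ} {z : E i}
    (hz : z ∈ cocycles d (powTorsionComplex E 𝔟) i)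
    (hx : x ^ n • z ∈ coboundaries d (powTorsionComplex E 𝔟) i) :
    ∃ y ∈ cocycles d (powTorsionComplex E (𝔟 ⊔ Ideal.span {x})) i,
      z - y ∈ coboundaries d (powTorsionComplex E 𝔟) i := by
  obtain ⟨e, he⟩ := exists_almostDivisible_powTorsion 𝔟 x
  obtain ⟨y, hy, h⟩ := exists_coboundary_smul_sub_eq_zero (fun i => he _ (hE i)) hx
  have hy' := coboundaries_le_cocycles hd (fun i _ hw => map_mem_powTorsion (d i) hw) i hy
  refine ⟨z - y, ⟨mem_powTorsion_sup_span_singleton.2 ⟨sub_mem hz.1 hy'.1, _, h⟩,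
    sub_mem hz.2 hy'.2⟩, by simpa using hy⟩

/-- If `c` kills `H^{i-1}_𝔟`, then it kills the kernel of `H^i_{𝔟 + (x)} → H^i_𝔟`. -/
lemma smul_mem_coboundaries_sup_span_singleton {𝔟 : Ideal R} {x c : R} {i : ℕ}
    (hc : ∀ j, j + 1 = i → ∀ u ∈ cocycles d (powTorsionComplex E 𝔟) j,
      c • u ∈ coboundaries d (powTorsionComplex E 𝔟) j) {z : E i}
    (hz : z ∈ cocycles d (powTorsionComplex E (𝔟 ⊔ Ideal.span {x})) i)
    (hz' : z ∈ coboundaries d (powTorsionComplex E 𝔟) i) :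
    c • z ∈ coboundaries d (powTorsionComplex E (𝔟 ⊔ Ideal.span {x})) i := by
  cases i with
  | zero => rw [(Submodule.mem_bot R).1 hz', smul_zero]; exact zero_mem _
  | succ i =>
    obtain ⟨w, hw, rfl⟩ := hz'
    obtain ⟨-, k, hk⟩ := mem_powTorsion_sup_span_singleton.1 hz.1
    obtain ⟨e, he⟩ := exists_almostDivisible_powTorsion 𝔟 x
    have h1 : x ^ k • c • w ∈ coboundaries d (powTorsionComplex E 𝔟) i := by
      rw [smul_comm]
      exact hc i rfl _ ⟨Submodule.smul_mem _ _ hw, by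
        change d i (x ^ k • w) = 0
        rw [map_smul, hk]⟩
    obtain ⟨y, hy, h⟩ := exists_coboundary_smul_sub_eq_zero (fun i => he _ (hE i)) h1
    have hy' := coboundaries_le_cocycles hd (fun i _ hw => map_mem_powTorsion (d i) hw) i hy
    refine ⟨c • w - y, mem_powTorsion_sup_span_singleton.2
      ⟨sub_mem (Submodule.smul_mem _ _ hw) hy'.1, _, h⟩, ?_⟩
    rw [map_sub, map_smul, hy'.2, sub_zero]

/-- The comparison of `H_𝔞` with `H_{𝔞 + (xs)}`, up to powers of `c`, when powers of `c` kill
`H^i_𝔞` for all `i < r` and `H^r_𝔞` is `x`-power torsion for the elements `x` of `xs`: powers of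
`c` kill `H^i_{𝔞 + (xs)}` for `i < r`, and they kill the kernel and the cokernel of
`H^r_{𝔞 + (xs)} → H^r_𝔞`. -/
lemma exists_pow_smul_comparison (𝔞 : Ideal R) (c : R) (r : ℕ)
    (hlow : ∀ i < r, ∃ N, ∀ z ∈ cocycles d (powTorsionComplex E 𝔞) i,
      c ^ N • z ∈ coboundaries d (powTorsionComplex E 𝔞) i) (xs : List R)
    (htors : ∀ x ∈ xs, ∀ z ∈ cocycles d (powTorsionComplex E 𝔞) r,
      ∃ k, x ^ k • z ∈ coboundaries d (powTorsionComplex E 𝔞) r) :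
    (∀ i < r, ∃ N, ∀ z ∈ cocycles d (powTorsionComplex E (𝔞 ⊔ Ideal.ofList xs)) i,
      c ^ N • z ∈ coboundaries d (powTorsionComplex E (𝔞 ⊔ Ideal.ofList xs)) i) ∧
    (∃ N, ∀ z ∈ cocycles d (powTorsionComplex E (𝔞 ⊔ Ideal.ofList xs)) r,
      z ∈ coboundaries d (powTorsionComplex E 𝔞) r →
      c ^ N • z ∈ coboundaries d (powTorsionComplex E (𝔞 ⊔ Ideal.ofList xs)) r) ∧
    (∃ N, ∀ z ∈ cocycles d (powTorsionComplex E 𝔞) r,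
      ∃ y ∈ cocycles d (powTorsionComplex E (𝔞 ⊔ Ideal.ofList xs)) r,
        c ^ N • z - y ∈ coboundaries d (powTorsionComplex E 𝔞) r) := by
  induction xs with
  | nil =>
    simp only [Ideal.ofList_nil, sup_bot_eq]
    exact ⟨hlow, ⟨0, fun z _ hz => by simpa using hz⟩, 0, fun z hz => ⟨z, hz, by simp⟩⟩
  | cons x xs ih =>
    obtain ⟨h1, ⟨N2, h2⟩, N3, h3⟩ := ih fun y hy => htors y (List.mem_cons_of_mem x hy)
    have hsup : 𝔞 ⊔ Ideal.ofList (x :: xs) = (𝔞 ⊔ Ideal.ofList xs) ⊔ Ideal.span {x} := by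
      rw [Ideal.ofList_cons, sup_assoc, sup_comm (Ideal.span {x})]
    rw [hsup]
    set 𝔟 := 𝔞 ⊔ Ideal.ofList xs with h𝔟
    have hmono (i : ℕ) : cocycles d (powTorsionComplex E (𝔟 ⊔ Ideal.span {x})) i ≤
        cocycles d (powTorsionComplex E 𝔟) i :=
      cocycles_mono (fun i => powTorsion_anti le_sup_left) i
    have hmono' (i : ℕ) : coboundaries d (powTorsionComplex E 𝔟) i ≤
        coboundaries d (powTorsionComplex E 𝔞) i :=
      coboundaries_mono (fun i => powTorsion_anti le_sup_left) i
    have hlow' (i : ℕ) (hi : i ≤ r) : ∃ N, ∀ z ∈ cocycles d (powTorsionComplex E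
        (𝔟 ⊔ Ideal.span {x})) i, z ∈ coboundaries d (powTorsionComplex E 𝔟) i →
        c ^ N • z ∈ coboundaries d (powTorsionComplex E (𝔟 ⊔ Ideal.span {x})) i := by
      cases i with
      | zero =>
        exact ⟨0, fun z hz hz' =>
          smul_mem_coboundaries_sup_span_singleton hd hE (by simp) hz hz'⟩
      | succ i =>
        obtain ⟨N, hN⟩ := h1 i hi
        refine ⟨N, fun z hz hz' => smul_mem_coboundaries_sup_span_singleton hd hE ?_ hz hz'⟩
        rintro j hj u hu
        obtain rfl : j = i := by omega
        exact hN u hu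
    refine ⟨fun i hi => ?_, ?_, N2 + N3, fun z hz => ?_⟩
    · obtain ⟨N, hN⟩ := h1 i hi
      obtain ⟨N', hN'⟩ := hlow' i hi.le
      refine ⟨N' + N, fun z hz => ?_⟩
      rw [pow_add, mul_smul]
      exact hN' _ (Submodule.smul_mem _ _ hz) (hN _ (hmono i hz))
    · obtain ⟨N', hN'⟩ := hlow' r le_rfl
      refine ⟨N' + N2, fun z hz hz' => ?_⟩
      rw [pow_add, mul_smul]
      exact hN' _ (Submodule.smul_mem _ _ hz) (h2 _ (hmono r hz) hz')
    · obtain ⟨y, hy, hzy⟩ := h3 z hz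
      obtain ⟨k, hk⟩ := htors x List.mem_cons_self z hz
      have h4 : x ^ k • y ∈ coboundaries d (powTorsionComplex E 𝔞) r := by
        have : x ^ k • y = c ^ N3 • x ^ k • z - x ^ k • (c ^ N3 • z - y) := by
          rw [smul_sub, smul_comm (c ^ N3), sub_sub_cancel]
        rw [this]
        exact sub_mem (Submodule.smul_mem _ _ hk) (Submodule.smul_mem _ _ hzy)
      have h5 := h2 _ (Submodule.smul_mem _ (x ^ k) hy) h4
      rw [smul_comm] at h5
      obtain ⟨y', hy', h6⟩ := exists_cocycle_sub_mem_coboundaries hd hE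
        (Submodule.smul_mem _ (c ^ N2) hy) h5
      refine ⟨y', hy', ?_⟩
      have : c ^ (N2 + N3) • z - y' = c ^ N2 • (c ^ N3 • z - y) + (c ^ N2 • y - y') := by
        rw [smul_sub, smul_smul, ← pow_add]; abel
      rw [this]
      exact add_mem (Submodule.smul_mem _ _ hzy) (hmono' r h6)

/-- If `𝔞 ≤ 𝔫`, powers of `c` kill `H^i_𝔞` for `i < r` as well as `H^r_𝔫`, and `H^r_𝔞` is
`𝔫`-torsion, then a power of `c` kills `H^r_𝔞`. -/
theorem exists_pow_smul_mem_coboundaries_of_torsion {𝔞 𝔫 : Ideal R} (h𝔞 : 𝔞 ≤ 𝔫) (c : R) (r : ℕ)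
    (hlow : ∀ i < r, ∃ N, ∀ z ∈ cocycles d (powTorsionComplex E 𝔞) i,
      c ^ N • z ∈ coboundaries d (powTorsionComplex E 𝔞) i)
    (hmax : ∃ N, ∀ z ∈ cocycles d (powTorsionComplex E 𝔫) r,
      c ^ N • z ∈ coboundaries d (powTorsionComplex E 𝔫) r)
    (htors : ∀ x ∈ 𝔫, ∀ z ∈ cocycles d (powTorsionComplex E 𝔞) r,
      ∃ k, x ^ k • z ∈ coboundaries d (powTorsionComplex E 𝔞) r) :
    ∃ N, ∀ z ∈ cocycles d (powTorsionComplex E 𝔞) r,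
      c ^ N • z ∈ coboundaries d (powTorsionComplex E 𝔞) r := by
  obtain ⟨S, hS⟩ := (isNoetherianRing_iff_ideal_fg R).1 ‹_› 𝔫
  have hlist : Ideal.ofList S.toList = 𝔫 := by
    rw [Ideal.ofList, ← hS]; congr 1; ext; simp
  have hsup : 𝔞 ⊔ Ideal.ofList S.toList = 𝔫 := by rw [hlist, sup_eq_right.2 h𝔞]
  obtain ⟨-, -, N, hN⟩ := exists_pow_smul_comparison hd hE 𝔞 c r hlow S.toList
    fun x hx => htors x (by rw [← hS]; exact Ideal.subset_span (by simpa using hx))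
  obtain ⟨N', hN'⟩ := hmax
  refine ⟨N' + N, fun z hz => ?_⟩
  obtain ⟨y, hy, h⟩ := hN z hz
  rw [hsup] at hy
  have := coboundaries_mono (fun i => powTorsion_anti h𝔞) r (hN' y hy)
  have h2 : c ^ (N' + N) • z = c ^ N' • (c ^ N • z - y) + c ^ N' • y := by
    rw [smul_sub, sub_add_cancel, smul_smul, ← pow_add]
  rw [h2]
  exact add_mem (Submodule.smul_mem _ _ h) this

end Enlarge

/-! ### Finiteness of local cohomology killed by powers of the ideal -/

section Finiteness

variable {R : Type u} [CommRing R]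

/-- The elements of `Γ_𝔞(E)` killed by `x ^ N` for all `x` in the list `l`. -/
abbrev torsionByPowersComplex (E : ℕ → Type u) [∀ i, AddCommGroup (E i)] [∀ i, Module R (E i)]
    (𝔞 : Ideal R) (l : List R) (N i : ℕ) : Submodule R (E i) :=
  powTorsion 𝔞 (E i) ⊓ Submodule.torsionBySet R (E i) (Ideal.ofList (l.map (· ^ N)) : Set R)

variable {E : ℕ → Type u} [∀ i, AddCommGroup (E i)] [∀ i, Module R (E i)]
  {d : ∀ i, E i →ₗ[R] E (i + 1)}

lemma mem_torsionByPowersComplex {𝔞 : Ideal R} {l : List R} {N i : ℕ} {w : E i} :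
    w ∈ torsionByPowersComplex E 𝔞 l N i ↔
      w ∈ powTorsion 𝔞 (E i) ∧ ∀ x ∈ l, x ^ N • w = 0 := by
  rw [Submodule.mem_inf, Ideal.ofList, ← Submodule.torsionBySet_eq_torsionBySet_span]
  simp [Submodule.mem_torsionBySet_iff]

lemma torsionByPowersComplex_mono {𝔞 : Ideal R} {l : List R} {N N' : ℕ} (h : N ≤ N') (i : ℕ) :
    torsionByPowersComplex E 𝔞 l N i ≤ torsionByPowersComplex E 𝔞 l N' i := by
  intro w hw
  rw [mem_torsionByPowersComplex] at hw ⊢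
  refine ⟨hw.1, fun x hx => ?_⟩
  rw [← Nat.sub_add_cancel h, pow_add, mul_smul, hw.2 x hx, smul_zero]

lemma torsionByPowersComplex_nil {𝔞 : Ideal R} (N : ℕ) :
    torsionByPowersComplex E 𝔞 [] N = powTorsionComplex E 𝔞 := by
  funext i
  ext w
  rw [mem_torsionByPowersComplex]
  simp

lemma mem_torsionByPowersComplex_cons {𝔞 : Ideal R} {x : R} {l : List R} {N i : ℕ} {w : E i} :
    w ∈ torsionByPowersComplex E 𝔞 (x :: l) N i ↔
      w ∈ torsionByPowersComplex E 𝔞 l N i ∧ x ^ N • w = 0 := by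
  simp only [mem_torsionByPowersComplex, List.forall_mem_cons]
  tauto

lemma map_mem_torsionByPowersComplex {𝔞 : Ideal R} {l : List R} {N : ℕ} (i : ℕ) (w : E i)
    (hw : w ∈ torsionByPowersComplex E 𝔞 l N i) :
    d i w ∈ torsionByPowersComplex E 𝔞 l N (i + 1) :=
  ⟨map_mem_powTorsion (d i) hw.1, map_mem_torsionBySet (d i) hw.2⟩

variable [IsNoetherianRing R] (hd : ∀ i w, d (i + 1) (d i w) = 0)
  (hE : ∀ i, Module.Injective R (E i))

include hd hE

/-- If a power of `𝔞` kills `H^i_𝔞` for `i < t`, then a power of `𝔞` also kills the transition maps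
between the cohomologies of the complexes of elements killed by `x ^ N`, `x ∈ l`, after a suitable
increase of the exponent `N`. -/
lemma exists_smul_mem_coboundaries_torsionByPowersComplex {𝔞 : Ideal R} {t M : ℕ}
    (hM : ∀ i < t, ∀ c ∈ 𝔞 ^ M, ∀ z ∈ cocycles d (powTorsionComplex E 𝔞) i,
      c • z ∈ coboundaries d (powTorsionComplex E 𝔞) i) (l : List R) (N : ℕ) :
    ∃ N' ≥ N, ∃ M, ∀ i < t, ∀ c ∈ 𝔞 ^ M,
      ∀ z ∈ cocycles d (torsionByPowersComplex E 𝔞 l N) i,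
        c • z ∈ coboundaries d (torsionByPowersComplex E 𝔞 l N') i := by
  induction l generalizing N with
  | nil =>
    refine ⟨N, le_rfl, M, ?_⟩
    simpa only [torsionByPowersComplex_nil] using hM
  | cons x l ih =>
    obtain ⟨N₁, hN₁, M₁, h₁⟩ := ih N
    obtain ⟨N₂, hN₂, M₂, h₂⟩ := ih N₁
    obtain ⟨e, he⟩ := exists_almostDivisible_powTorsion_inf 𝔞 (Ideal.ofList (l.map (· ^ N₂))) x
    refine ⟨max N₂ (N + e), (hN₁.trans hN₂).trans (le_max_left _ _), M₂ + M₁, ?_⟩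
    intro i hi c hc z hz
    have hzl : z ∈ cocycles d (torsionByPowersComplex E 𝔞 l N) i :=
      ⟨(mem_torsionByPowersComplex_cons.1 hz.1).1, hz.2⟩
    cases i with
    | zero =>
      have := h₁ 0 hi c (Ideal.pow_le_pow_right (Nat.le_add_left _ _) hc) z hzl
      rw [(Submodule.mem_bot R).1 this]
      exact zero_mem _
    | succ i =>
      rw [pow_add] at hc
      refine Submodule.mul_induction_on hc (fun c₂ hc₂ c₁ hc₁ => ?_)
        (fun c c' hc hc' => by rw [add_smul]; exact add_mem hc hc')
      obtain ⟨w, hw, hwz⟩ := h₁ _ hi c₁ hc₁ z hzl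
      have hxw : x ^ N • w ∈ cocycles d (torsionByPowersComplex E 𝔞 l N₁) i := by
        refine ⟨Submodule.smul_mem _ _ hw, ?_⟩
        change d i (x ^ N • w) = 0
        rw [map_smul, hwz, smul_comm, (mem_torsionByPowersComplex_cons.1 hz.1).2, smul_zero]
      have h3 := h₂ i (by omega) c₂ hc₂ _ hxw
      rw [smul_comm] at h3
      obtain ⟨y, hy, hxy⟩ := exists_coboundary_smul_sub_eq_zero (fun i => he _ (hE i)) h3
      have hy' := coboundaries_le_cocycles hd map_mem_torsionByPowersComplex i hy
      refine ⟨c₂ • w - y, mem_torsionByPowersComplex_cons.2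
        ⟨torsionByPowersComplex_mono (le_max_left _ _) i (sub_mem (Submodule.smul_mem _ _
          (torsionByPowersComplex_mono hN₂ i hw)) hy'.1), ?_⟩, ?_⟩
      · rw [← Nat.sub_add_cancel (le_max_right N₂ (N + e)), pow_add, mul_smul, hxy, smul_zero]
      · rw [map_sub, map_smul, hwz, hy'.2, sub_zero, mul_smul]

/-- If a power of `𝔞` kills `H^i_𝔞` for `i < t`, then each class of these degrees has a
representative killed by fixed powers of finitely many given elements of `𝔞`. -/
lemma exists_sub_mem_coboundaries_torsionByPowersComplex {𝔞 : Ideal R} {t M : ℕ}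
    (hM : ∀ i < t, ∀ c ∈ 𝔞 ^ M, ∀ z ∈ cocycles d (powTorsionComplex E 𝔞) i,
      c • z ∈ coboundaries d (powTorsionComplex E 𝔞) i) (l : List R) (hl : ∀ x ∈ l, x ∈ 𝔞) :
    ∃ N, ∀ i < t, ∀ z ∈ cocycles d (powTorsionComplex E 𝔞) i,
      ∃ y ∈ cocycles d (torsionByPowersComplex E 𝔞 l N) i,
        z - y ∈ coboundaries d (powTorsionComplex E 𝔞) i := by
  induction l with
  | nil =>
    refine ⟨0, fun i _ z hz => ⟨z, ?_, by simp⟩⟩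
    simpa only [torsionByPowersComplex_nil] using hz
  | cons x l ih =>
    obtain ⟨N, hN⟩ := ih fun y hy => hl y (List.mem_cons_of_mem x hy)
    obtain ⟨N₁, hN₁, M₁, h₁⟩ :=
      exists_smul_mem_coboundaries_torsionByPowersComplex hd hE hM l N
    obtain ⟨e, he⟩ := exists_almostDivisible_powTorsion_inf 𝔞 (Ideal.ofList (l.map (· ^ N₁))) x
    refine ⟨max N₁ (M₁ + e), fun i hi z hz => ?_⟩
    obtain ⟨y, hy, hzy⟩ := hN i hi z hz
    obtain ⟨y', hy', hxy⟩ := exists_coboundary_smul_sub_eq_zero (fun i => he _ (hE i))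
      (h₁ i hi _ (Ideal.pow_mem_pow (hl x List.mem_cons_self) M₁) y hy)
    have hy'' := coboundaries_le_cocycles hd map_mem_torsionByPowersComplex i hy'
    refine ⟨y - y', ⟨mem_torsionByPowersComplex_cons.2
      ⟨torsionByPowersComplex_mono (le_max_left _ _) i
        (sub_mem (torsionByPowersComplex_mono hN₁ i hy.1) hy''.1), ?_⟩,
        sub_mem hy.2 hy''.2⟩, ?_⟩
    · rw [← Nat.sub_add_cancel (le_max_right N₁ (M₁ + e)), pow_add, mul_smul, hxy, smul_zero]
    · rw [← sub_add]
      exact add_mem hzy (coboundaries_mono (fun i => inf_le_left) i hy')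

/-- If a power of `𝔞` kills `H^i_𝔞` for all `i < t`, then for these `i` the module `H^i_𝔞` is a
quotient of some `Ext^i(R ⧸ 𝔟, M)`, and so it is finitely generated if these modules are. -/
theorem finite_cohomology_powTorsionComplex {𝔞 : Ideal R} {t : ℕ}
    (h : ∀ i < t, 𝔞 ≤ (Module.annihilator R (Cohomology d (powTorsionComplex E 𝔞) i)).radical)
    (hfin : ∀ (𝔟 : Ideal R) (i : ℕ), Module.Finite R (Cohomology d (torsionByComplex E 𝔟) i)) :
    ∀ i < t, Module.Finite R (Cohomology d (powTorsionComplex E 𝔞) i) := by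
  have hpow : ∀ i < t, ∃ M, 𝔞 ^ M ≤ Module.annihilator R
      (Cohomology d (powTorsionComplex E 𝔞) i) := fun i hi =>
    Ideal.exists_pow_le_of_le_radical_of_fg (h i hi) ((isNoetherianRing_iff_ideal_fg R).1 ‹_› 𝔞)
  choose! m hm using hpow
  obtain ⟨S, hS⟩ := (isNoetherianRing_iff_ideal_fg R).1 ‹_› 𝔞
  have hmem (x : R) (hx : x ∈ S.toList) : x ∈ 𝔞 := by
    rw [← hS]; exact Ideal.subset_span (by simpa using hx)
  obtain ⟨N, hN⟩ := exists_sub_mem_coboundaries_torsionByPowersComplex hd hE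
    (t := t) (M := (Finset.range t).sup m) (fun i hi c hc z hz => by
      rw [← mk_eq_zero_iff_mem_coboundaries (Submodule.smul_mem _ c hz)]
      exact Module.mem_annihilator.1 (hm i hi (Ideal.pow_le_pow_right
        (Finset.le_sup (f := m) (Finset.mem_range.2 hi)) hc)) (Submodule.Quotient.mk ⟨z, hz⟩))
    S.toList hmem
  set 𝔟 := Ideal.ofList (S.toList.map (· ^ N)) with h𝔟
  obtain ⟨k, hk⟩ : ∃ k, 𝔞 ^ k ≤ 𝔟 := by
    refine Ideal.exists_pow_le_of_le_radical_of_fg ?_ ⟨S, hS⟩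
    rw [← hS]
    refine Ideal.span_le.2 fun x hx => ⟨N, Ideal.subset_span ?_⟩
    simpa using ⟨x, by simpa using hx, rfl⟩
  have hle (i : ℕ) : torsionByComplex E 𝔟 i ≤ powTorsionComplex E 𝔞 i :=
    (torsionBySet_anti hk).trans (torsionBySet_pow_le_powTorsion 𝔞 k)
  intro i hi
  have := hfin 𝔟 i
  refine Module.Finite.of_surjective (cohomologyMap hle i) fun u => ?_
  obtain ⟨⟨z, hz⟩, rfl⟩ := Submodule.Quotient.mk_surjective _ u
  obtain ⟨y, hy, hzy⟩ := hN i hi z hz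
  have hy' : y ∈ cocycles d (torsionByComplex E 𝔟) i := ⟨hy.1.2, hy.2⟩
  refine ⟨Submodule.Quotient.mk ⟨y, hy'⟩, ?_⟩
  rw [cohomologyMap_mk, eq_comm, Submodule.Quotient.eq]
  exact hzy

end Finiteness

/-! ### The first nonvanishing degree -/

section FirstDegree

variable {R : Type u} [CommRing R]

/-- The restriction of `f` to `K` has a linear section over its image if its kernel is an injective
module. -/
lemma exists_linear_section {E F : Type u} [AddCommGroup E] [Module R E] [AddCommGroup F]
    [Module R F] (f : E →ₗ[R] F) (K : Submodule R E)
    (hker : Module.Injective R ↥(K ⊓ LinearMap.ker f)) :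
    ∃ σ : ↥(K.map f) →ₗ[R] E, ∀ y, σ y ∈ K ∧ f (σ y) = y := by
  let Z : Submodule R E := K ⊓ LinearMap.ker f
  obtain ⟨ρ, hρ⟩ := hker.out (Submodule.inclusion (inf_le_left : Z ≤ K))
    (Submodule.inclusion_injective _) LinearMap.id
  let g : K →ₗ[R] K.map f := f.submoduleMap K
  have hg : Function.Surjective g := f.submoduleMap_surjective K
  let p : K →ₗ[R] E := K.subtype - Z.subtype ∘ₗ ρ
  have hp : LinearMap.ker g ≤ LinearMap.ker p := by
    intro w hw
    have hw' : (w : E) ∈ Z := ⟨w.2, congrArg Subtype.val (LinearMap.mem_ker.1 hw)⟩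
    have := hρ ⟨w, hw'⟩
    change (w : E) - (ρ w : E) = 0
    rw [sub_eq_zero]
    exact (congrArg Subtype.val this).symm
  have hpw (w : K) : p w ∈ K ∧ f (p w) = f w := by
    refine ⟨sub_mem w.2 (ρ w).2.1, ?_⟩
    change f ((w : E) - (ρ w : E)) = _
    rw [map_sub, (ρ w).2.2, sub_zero]
  refine ⟨(LinearMap.ker g).liftQ p hp ∘ₗ (g.quotKerEquivOfSurjective hg).symm, fun y => ?_⟩
  obtain ⟨w, rfl⟩ := hg y
  have : (g.quotKerEquivOfSurjective hg).symm (g w) = Submodule.Quotient.mk w := by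
    rw [LinearEquiv.symm_apply_eq]; rfl
  simp only [LinearMap.comp_apply, LinearEquiv.coe_coe, this, Submodule.liftQ_apply]
  exact hpw w

lemma injective_map_of_injective {E F : Type u} [AddCommGroup E] [Module R E] [AddCommGroup F]
    [Module R F] (f : E →ₗ[R] F) (K : Submodule R E) (hK : Module.Injective R K)
    (hker : Module.Injective R ↥(K ⊓ LinearMap.ker f)) :
    Module.Injective R (K.map f) := by
  obtain ⟨σ, hσ⟩ := exists_linear_section f K hker
  refine ⟨fun X Y _ _ _ _ i hi g => ?_⟩
  obtain ⟨h, hh⟩ := hK.out i hi (σ.codRestrict K (fun y => (hσ y).1) ∘ₗ g)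
  refine ⟨f.submoduleMap K ∘ₗ h, fun x => Subtype.ext ?_⟩
  change f (h (i x)) = _
  rw [hh]
  exact (hσ (g x)).2

variable {E : ℕ → Type u} [∀ i, AddCommGroup (E i)] [∀ i, Module R (E i)]
  {d : ∀ i, E i →ₗ[R] E (i + 1)} {K : ∀ i, Submodule R (E i)}

lemma injective_coboundaries (hd : ∀ i w, d (i + 1) (d i w) = 0)
    (hdK : ∀ i, ∀ w ∈ K i, d i w ∈ K (i + 1))
    (hK : ∀ i, Module.Injective R (K i)) {t : ℕ}
    (hex : ∀ i < t, cocycles d K i ≤ coboundaries d K i) :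
    ∀ i ≤ t, Module.Injective R (coboundaries d K i) := by
  intro i
  induction i with
  | zero =>
    refine fun _ => ⟨fun X Y _ _ _ _ i hi g => ⟨0, fun x => Subtype.ext ?_⟩⟩
    exact ((Submodule.mem_bot R).1 (g x).2).symm
  | succ i ih =>
    intro hi
    refine injective_map_of_injective (d i) (K i) (hK i) ?_
    have : K i ⊓ LinearMap.ker (d i) = coboundaries d K i :=
      le_antisymm (hex i hi) (coboundaries_le_cocycles hd hdK i)
    rw [this]
    exact ih (by omega)

variable [IsNoetherianRing R]

/-- If `Ext^i(R ⧸ 𝔟, M) = 0` for all `i < t`, then `H^i_𝔟(M) = 0` for all `i < t`. -/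
theorem cocycles_powTorsionComplex_le (hd : ∀ i w, d (i + 1) (d i w) = 0)
    (hE : ∀ i, Module.Injective R (E i)) {𝔟 : Ideal R} {t : ℕ}
    (h : ∀ i < t, cocycles d (torsionByComplex E 𝔟) i ≤
      coboundaries d (torsionByComplex E 𝔟) i) :
    ∀ i < t, cocycles d (powTorsionComplex E 𝔟) i ≤
      coboundaries d (powTorsionComplex E 𝔟) i := by
  intro i
  induction i using Nat.strong_induction_on with
  | _ i ih =>
    intro hi
    have hdK : ∀ i, ∀ w ∈ powTorsionComplex E 𝔟 i, d i w ∈ powTorsionComplex E 𝔟 (i + 1) :=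
      fun i w hw => map_mem_powTorsion (d i) hw
    have hinj := injective_coboundaries hd hdK (fun i => injective_powTorsion 𝔟 (hE i))
      (fun j hj => ih j hj (hj.trans hi)) i le_rfl
    have hmono := coboundaries_mono (d := d) (fun i => (by
      simpa using torsionBySet_pow_le_powTorsion (E := E i) 𝔟 1 :
        torsionByComplex E 𝔟 i ≤ powTorsionComplex E 𝔟 i)) i
    -- By injectivity of the coboundaries, a cocycle which `𝔟` multiplies into the coboundaries
    -- agrees with one killed by `𝔟` up to a coboundary.
    have key (z : E i) (hz : z ∈ cocycles d (powTorsionComplex E 𝔟) i)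
        (hbz : ∀ c ∈ 𝔟, c • z ∈ coboundaries d (powTorsionComplex E 𝔟) i) :
        z ∈ coboundaries d (powTorsionComplex E 𝔟) i := by
      let f : 𝔟 →ₗ[R] coboundaries d (powTorsionComplex E 𝔟) i :=
        (LinearMap.toSpanSingleton R (E i) z ∘ₗ 𝔟.subtype).codRestrict _ fun c => hbz c c.2
      obtain ⟨g, hg⟩ := hinj.out 𝔟.subtype 𝔟.injective_subtype f
      have hy := coboundaries_le_cocycles hd hdK i (g 1).2
      have hzy : z - g 1 ∈ cocycles d (torsionByComplex E 𝔟) i := by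
        refine ⟨mem_torsionBySet_ideal.2 fun c hc => ?_, sub_mem hz.2 hy.2⟩
        have : c • z = c • (g 1 : E i) := by
          rw [← Submodule.coe_smul, ← map_smul, smul_eq_mul, mul_one]
          exact (congrArg Subtype.val (hg ⟨c, hc⟩)).symm
        rw [smul_sub, this, sub_self]
      rw [← sub_add_cancel z (g 1 : E i)]
      exact add_mem (hmono (h i hi hzy)) (g 1).2
    have main (n : ℕ) : ∀ z ∈ cocycles d (powTorsionComplex E 𝔟) i,
        (∀ c ∈ 𝔟 ^ n, c • z ∈ coboundaries d (powTorsionComplex E 𝔟) i) →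
        z ∈ coboundaries d (powTorsionComplex E 𝔟) i := by
      induction n with
      | zero => exact fun z _ hc => by simpa using hc 1 (by simp)
      | succ n ihn =>
        refine fun z hz hc => key z hz fun c hc' => ihn _ (Submodule.smul_mem _ c hz) ?_
        intro c' hc''
        rw [smul_smul]
        exact hc _ (by rw [pow_succ]; exact Ideal.mul_mem_mul hc'' hc')
    intro z hz
    obtain ⟨n, hn⟩ := hz.1
    exact main n z hz fun c hc => by
      rw [mem_torsionBySet_ideal.1 hn c hc]; exact zero_mem _

/-- If `H^i_𝔟(M) = 0` for all `i ≤ r`, then `Ext^r(R ⧸ 𝔟, M) = 0`. -/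
theorem cocycles_torsionByComplex_le (hd : ∀ i w, d (i + 1) (d i w) = 0)
    (hE : ∀ i, Module.Injective R (E i)) {𝔟 : Ideal R} {r : ℕ}
    (h : ∀ i ≤ r, cocycles d (powTorsionComplex E 𝔟) i ≤
      coboundaries d (powTorsionComplex E 𝔟) i) :
    cocycles d (torsionByComplex E 𝔟) r ≤ coboundaries d (torsionByComplex E 𝔟) r := by
  intro z hz
  have hz' : z ∈ coboundaries d (powTorsionComplex E 𝔟) r :=
    h r le_rfl ⟨⟨1, by simpa using hz.1⟩, hz.2⟩
  have hdK : ∀ i, ∀ w ∈ powTorsionComplex E 𝔟 i, d i w ∈ powTorsionComplex E 𝔟 (i + 1) :=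
    fun i w hw => map_mem_powTorsion (d i) hw
  cases r with
  | zero => exact hz'
  | succ j =>
    have hinj := injective_coboundaries hd hdK (fun i => injective_powTorsion 𝔟 (hE i))
      (t := j) (fun i hi => h i (by omega)) j le_rfl
    rw [← le_antisymm (h j (by omega)) (coboundaries_le_cocycles hd hdK j)] at hinj
    obtain ⟨σ, hσ⟩ := exists_linear_section (d j) (powTorsionComplex E 𝔟 j) hinj
    refine ⟨σ ⟨z, hz'⟩, mem_torsionBySet_ideal.2 fun c hc => ?_, (hσ ⟨z, hz'⟩).2⟩
    have : c • (⟨z, hz'⟩ : (powTorsionComplex E 𝔟 j).map (d j)) = 0 :=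
      Subtype.ext (mem_torsionBySet_ideal.1 hz.1 c hc)
    rw [← map_smul, this, map_zero]

end FirstDegree

/-! ### Comparison of the two constructions of `Ext` -/

open CochainComplex.HomComplex Abelian in
lemma CategoryTheory.ProjectiveResolution.extMk_eq_zero_iff_of_zero {C : Type*}
    [Category* C] [Abelian C] [HasExt.{u} C] {X Y : C} (R : ProjectiveResolution X)
    (f : R.complex.X 0 ⟶ Y)
    (hf : R.complex.d 1 0 ≫ f = 0) :
    R.extMk f 1 rfl hf = 0 ↔ f = 0 := by
  simp only [← R.extEquivCohomologyClass.apply_eq_iff_eq,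
    ProjectiveResolution.extEquivCohomologyClass_extMk,
    ProjectiveResolution.extEquivCohomologyClass_zero, CohomologyClass.mk_eq_zero_iff]
  rw [Cocycle.toSingleMk_mem_coboundaries_iff _ _ _ _ _ 1 (by lia)]
  have : Limits.IsZero (R.cochainComplex.X 1) :=
    CochainComplex.isZero_of_isStrictlyLE _ 0 _ (by simp)
  constructor
  · rintro ⟨g, hg⟩
    rw [this.eq_of_src g 0, Limits.comp_zero] at hg
    simpa using hg.symm
  · rintro rfl
    exact ⟨0, by simp⟩

open CochainComplex.HomComplex Abelian in
lemma CategoryTheory.InjectiveResolution.extMk_eq_zero_iff_of_zero {C : Type*}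
    [Category* C] [Abelian C] [HasExt.{u} C] {X Y : C} (R : InjectiveResolution Y)
    (f : X ⟶ R.cocomplex.X 0)
    (hf : f ≫ R.cocomplex.d 0 1 = 0) :
    R.extMk f 1 rfl hf = 0 ↔ f = 0 := by
  simp only [← R.extEquivCohomologyClass.apply_eq_iff_eq,
    InjectiveResolution.extEquivCohomologyClass_extMk,
    InjectiveResolution.extEquivCohomologyClass_zero, CohomologyClass.mk_eq_zero_iff]
  rw [Cocycle.fromSingleMk_mem_coboundaries_iff _ _ _ _ _ (-1) (by lia)]
  have : Limits.IsZero (R.cochainComplex.X (-1)) := R.cocomplex.isZero_extend_X _ _ (by simp)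
  constructor
  · rintro ⟨g, hg⟩
    rw [this.eq_of_tgt g 0, Limits.zero_comp] at hg
    simpa using hg.symm
  · rintro rfl
    exact ⟨0, by simp⟩

section ProjectiveSide

variable {R : Type u} [CommRing R] {X X' : ModuleCat.{u} R}

/-- The morphism of complexes `Hom(P, M) ⟶ Hom(P', M)` induced by `P' ⟶ P`. -/
noncomputable def linearYonedaObjMap {P : ProjectiveResolution X} {P' : ProjectiveResolution X'}
    (φ : P'.complex ⟶ P.complex) (M : ModuleCat.{u} R) :
    P.complex.linearYonedaObj R M ⟶ P'.complex.linearYonedaObj R M :=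
  (HomologicalComplex.unopFunctor _ _).map
    ((((linearYoneda R (ModuleCat.{u} R)).obj M).rightOp.mapHomologicalComplex _).map φ).op

/-- Naturality in `X` of the computation of `Ext^n(X, M)` by projective resolutions. -/
lemma ext_map_comp_isoExt_hom {g : X' ⟶ X} {P : ProjectiveResolution X}
    {P' : ProjectiveResolution X'} (φ : ProjectiveResolution.Hom P' P g) (M : ModuleCat.{u} R)
    (n : ℕ) :
    ((Ext R (ModuleCat.{u} R) n).map g.op).app M ≫ (P'.isoExt n M).hom =
      (P.isoExt n M).hom ≫ HomologicalComplex.homologyMap (linearYonedaObjMap φ.hom M) n := by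
  let F := ((linearYoneda R (ModuleCat.{u} R)).obj M).rightOp
  let K := (F.mapHomologicalComplex (ComplexShape.down ℕ)).obj P.complex
  let K' := (F.mapHomologicalComplex (ComplexShape.down ℕ)).obj P'.complex
  let ψ : K' ⟶ K := (F.mapHomologicalComplex (ComplexShape.down ℕ)).map φ.hom
  let a : (F.leftDerived n).obj X ≅ K.homology n := P.isoLeftDerivedObj F n
  let a' : (F.leftDerived n).obj X' ≅ K'.homology n := P'.isoLeftDerivedObj F n
  have h : a'.inv ≫ (F.leftDerived n).map g = HomologicalComplex.homologyMap ψ n ≫ a.inv :=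
    ProjectiveResolution.isoLeftDerivedObj_inv_naturality g P' P φ.hom
      φ.hom_f_zero_comp_π_f_zero F n
  have h1 : ((F.leftDerived n).map g).unop ≫ a'.inv.unop =
      a.inv.unop ≫ (HomologicalComplex.homologyMap ψ n).unop := by
    rw [← unop_comp, h, unop_comp]
  let b : (K.homology n).unop ≅ (P.complex.linearYonedaObj R M).homology n :=
    (K.homologyUnop n).symm
  let b' : (K'.homology n).unop ≅ (P'.complex.linearYonedaObj R M).homology n :=
    (K'.homologyUnop n).symm
  have h2 : (HomologicalComplex.homologyMap ψ n).unop ≫ b'.hom =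
      b.hom ≫ HomologicalComplex.homologyMap (linearYonedaObjMap φ.hom M) n := by
    have := congrArg Quiver.Hom.unop (ShortComplex.homologyOpIso_inv_naturality
      ((HomologicalComplex.shortComplexFunctor _ _ n).map (linearYonedaObjMap φ.hom M)))
    rw [unop_comp, unop_comp] at this
    exact this.symm
  change ((F.leftDerived n).map g).unop ≫ a'.inv.unop ≫ b'.hom =
    (a.inv.unop ≫ b.hom) ≫ HomologicalComplex.homologyMap (linearYonedaObjMap φ.hom M) n
  rw [Category.assoc, ← h2, ← Category.assoc, h1, Category.assoc]

lemma homologyπ_eq_zero_iff (K : CochainComplex (ModuleCat.{u} R) ℕ) (i j : ℕ)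
    (h : (ComplexShape.up ℕ).prev j = i) (x : K.cycles j) :
    K.homologyπ j x = 0 ↔ ∃ y, K.d i j y = K.iCycles j x := by
  have := ShortComplex.exact_of_g_is_cokernel
    (ShortComplex.mk _ _ (K.toCycles_comp_homologyπ i j)) (K.homologyIsCokernel i j h)
  rw [ShortComplex.moduleCat_exact_iff] at this
  constructor
  · intro hx
    obtain ⟨y, hy⟩ := this x hx
    refine ⟨y, ?_⟩
    rw [← hy]
    dsimp
    rw [← K.toCycles_i i j]
    rfl
  · rintro ⟨y, hy⟩
    have : x = K.toCycles i j y := by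
      apply (ModuleCat.mono_iff_injective (K.iCycles j)).1 inferInstance
      rw [← hy, ← K.toCycles_i i j]
      rfl
    rw [this]
    exact congr($(K.toCycles_comp_homologyπ i j) y)

open CategoryTheory.Abelian

lemma exists_linearEquiv_of_ker_eq {A B C : Type*} [AddCommGroup A] [Module R A]
    [AddCommGroup B] [Module R B] [AddCommGroup C] [Module R C] {f : A →ₗ[R] B} {g : A →ₗ[R] C}
    (hf : Function.Surjective f) (hg : Function.Surjective g)
    (h : LinearMap.ker f = LinearMap.ker g) : ∃ e : B ≃ₗ[R] C, ∀ a, e (f a) = g a := by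
  refine ⟨(f.quotKerEquivOfSurjective hf).symm ≪≫ₗ
    Submodule.quotEquivOfEq _ _ h ≪≫ₗ g.quotKerEquivOfSurjective hg, fun a => ?_⟩
  have : (f.quotKerEquivOfSurjective hf).symm (f a) = Submodule.Quotient.mk a := by
    rw [LinearEquiv.symm_apply_eq]; rfl
  simp only [LinearEquiv.trans_apply, this]
  rfl

lemma projective_extMk_smul (P : ProjectiveResolution X) (M : ModuleCat.{u} R) {n : ℕ}
    (r : R) (f : P.complex.X n ⟶ M) (hf : P.complex.d (n + 1) n ≫ f = 0) :
    P.extMk (r • f) (n + 1) rfl (by rw [Linear.comp_smul, hf, smul_zero]) =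
      r • P.extMk f (n + 1) rfl hf := by
  rw [Ext.smul_eq_comp_mk₀, P.extMk_comp_mk₀]
  simp only [Linear.comp_smul, Category.comp_id]

/-- A cocycle of `Hom(P, M)`, as a morphism. -/
noncomputable def cyclesToHom (P : ProjectiveResolution X) (M : ModuleCat.{u} R) (n : ℕ) :
    (P.complex.linearYonedaObj R M).cycles n →ₗ[R] (P.complex.X n ⟶ M) :=
  ((P.complex.linearYonedaObj R M).iCycles n).hom

lemma d_comp_cyclesToHom (P : ProjectiveResolution X) (M : ModuleCat.{u} R) (n : ℕ)
    (x : (P.complex.linearYonedaObj R M).cycles n) :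
    P.complex.d (n + 1) n ≫ cyclesToHom P M n x = 0 :=
  congr($((P.complex.linearYonedaObj R M).iCycles_d n (n + 1)) x)

lemma exists_cyclesToHom_eq (P : ProjectiveResolution X) (M : ModuleCat.{u} R) {n : ℕ}
    (f : P.complex.X n ⟶ M) (hf : P.complex.d (n + 1) n ≫ f = 0) :
    ∃ x, cyclesToHom P M n x = f := by
  let K := P.complex.linearYonedaObj R M
  have hex : (ShortComplex.mk _ _ (K.iCycles_d n (n + 1))).Exact :=
    ShortComplex.exact_of_f_is_kernel _ (K.cyclesIsKernel n (n + 1) (by simp))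
  exact (ShortComplex.moduleCat_exact_iff _).1 hex f hf

/-- The class in `Ext^n(X, M)` of a cocycle of `Hom(P, M)`. -/
noncomputable def extOfCycles (P : ProjectiveResolution X) (M : ModuleCat.{u} R) (n : ℕ) :
    (P.complex.linearYonedaObj R M).cycles n →ₗ[R] Abelian.Ext X M n where
  toFun x := P.extMk (cyclesToHom P M n x) (n + 1) rfl (d_comp_cyclesToHom P M n x)
  map_add' x y := by
    rw [P.add_extMk]
    simp only [map_add]
  map_smul' r x := by
    rw [RingHom.id_apply, ← projective_extMk_smul]
    simp only [map_smul]

lemma extOfCycles_apply (P : ProjectiveResolution X) (M : ModuleCat.{u} R) (n : ℕ)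
    (x : (P.complex.linearYonedaObj R M).cycles n) : extOfCycles P M n x =
      P.extMk (cyclesToHom P M n x) (n + 1) rfl (d_comp_cyclesToHom P M n x) := rfl

lemma extOfCycles_surjective (P : ProjectiveResolution X) (M : ModuleCat.{u} R) (n : ℕ) :
    Function.Surjective (extOfCycles P M n) := by
  intro α
  obtain ⟨f, hf, rfl⟩ := P.extMk_surjective α (n + 1) rfl
  obtain ⟨x, rfl⟩ := exists_cyclesToHom_eq P M f hf
  exact ⟨x, rfl⟩

lemma extOfCycles_eq_zero_iff (P : ProjectiveResolution X) (M : ModuleCat.{u} R) (n : ℕ)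
    (x : (P.complex.linearYonedaObj R M).cycles n) :
    extOfCycles P M n x = 0 ↔ (P.complex.linearYonedaObj R M).homologyπ n x = 0 := by
  rw [extOfCycles_apply]
  cases n with
  | zero =>
    rw [homologyπ_eq_zero_iff _ 0 0 (by simp), P.extMk_eq_zero_iff_of_zero]
    refine ⟨fun h => ⟨0, ?_⟩, fun ⟨y, hy⟩ => ?_⟩
    · rw [map_zero]; exact h.symm
    · refine hy.symm.trans ?_
      rw [HomologicalComplex.shape _ _ _ (by simp)]; rfl
  | succ n =>
    rw [homologyπ_eq_zero_iff _ n (n + 1) (by simp)]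
    exact P.extMk_eq_zero_iff _ _ _ _ n rfl

/-- The modules `Ext^n(X, M)` of the two constructions are isomorphic, naturally in `X`. -/
theorem exists_natural_linearEquiv_ext (M : ModuleCat.{u} R) (n : ℕ) :
    ∃ e : ∀ X : ModuleCat.{u} R,
      ((_root_.Ext R (ModuleCat.{u} R) n).obj (Opposite.op X)).obj M ≃ₗ[R] Abelian.Ext X M n,
      ∀ (X X' : ModuleCat.{u} R) (g : X' ⟶ X) u,
        e X' (((_root_.Ext R (ModuleCat.{u} R) n).map g.op).app M u) =
          (Ext.mk₀ g).comp (e X u) (zero_add n) := by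
  let P (X : ModuleCat.{u} R) : ProjectiveResolution X := projectiveResolution X
  have hπ (X : ModuleCat.{u} R) :
      Function.Surjective (((P X).complex.linearYonedaObj R M).homologyπ n) :=
    (ModuleCat.epi_iff_surjective _).1 inferInstance
  have h (X : ModuleCat.{u} R) := exists_linearEquiv_of_ker_eq
    (f := (((P X).complex.linearYonedaObj R M).homologyπ n).hom) (g := extOfCycles (P X) M n)
    (hπ X) (extOfCycles_surjective _ _ _)
    (by ext x; exact (extOfCycles_eq_zero_iff (P X) M n x).symm)
  choose e he using h
  refine ⟨fun X => ((P X).isoExt n M).toLinearEquiv ≪≫ₗ e X, fun X X' g u => ?_⟩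
  let φ : ProjectiveResolution.Hom (P X') (P X) g :=
    { hom := ProjectiveResolution.lift g (P X') (P X)
      hom_f_zero_comp_π_f_zero :=
        congr(HomologicalComplex.Hom.f $(ProjectiveResolution.lift_commutes g (P X') (P X)) 0) }
  obtain ⟨x, hx⟩ := hπ X (((P X).isoExt n M).hom u)
  have h1 : ((P X').isoExt n M).hom (((_root_.Ext R (ModuleCat.{u} R) n).map g.op).app M u) =
      HomologicalComplex.homologyMap (linearYonedaObjMap φ.hom M) n (((P X).isoExt n M).hom u) :=
    congr($(ext_map_comp_isoExt_hom φ M n) u)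
  have h2 : HomologicalComplex.homologyMap (linearYonedaObjMap φ.hom M) n
        (((P X).complex.linearYonedaObj R M).homologyπ n x) =
      ((P X').complex.linearYonedaObj R M).homologyπ n
        (HomologicalComplex.cyclesMap (linearYonedaObjMap φ.hom M) n x) :=
    congr($(HomologicalComplex.homologyπ_naturality (linearYonedaObjMap φ.hom M) n) x)
  have h3 : cyclesToHom (P X') M n
      (HomologicalComplex.cyclesMap (linearYonedaObjMap φ.hom M) n x) =
      φ.hom.f n ≫ cyclesToHom (P X) M n x :=
    congr($(HomologicalComplex.cyclesMap_i (linearYonedaObjMap φ.hom M) n) x)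
  change e X' (((P X').isoExt n M).hom _) = Ext.comp _ (e X (((P X).isoExt n M).hom u)) _
  rw [h1, ← hx, h2]
  refine (he X' _).trans ?_
  refine Eq.trans ?_ (congrArg (fun a => (Ext.mk₀ g).comp a (zero_add n)) (he X x).symm)
  rw [extOfCycles_apply, extOfCycles_apply]
  simp only [h3]
  exact (ProjectiveResolution.mk₀_comp_extMk _ _ _ _ φ).symm

end ProjectiveSide

/-! ### `Ext` and local cohomology by injective resolutions -/

section InjectiveSide

open CategoryTheory.Abelian

variable {R : Type u} [CommRing R] {M : ModuleCat.{u} R} (I : InjectiveResolution M)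

/-- The terms of an injective resolution. -/
abbrev injTerm (i : ℕ) : Type u := I.cocomplex.X i

/-- The differentials of an injective resolution. -/
abbrev injDiff (i : ℕ) : injTerm I i →ₗ[R] injTerm I (i + 1) := (I.cocomplex.d i (i + 1)).hom

lemma injDiff_injDiff (i : ℕ) (w : injTerm I i) : injDiff I (i + 1) (injDiff I i w) = 0 :=
  congr($(I.cocomplex.d_comp_d i (i + 1) (i + 2)) w)

lemma injective_injTerm (i : ℕ) : Module.Injective R (injTerm I i) := by
  have : Injective (ModuleCat.of R (injTerm I i)) := I.injective i
  exact Module.injective_module_of_injective_object R (injTerm I i)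

/-- The morphism from `R ⧸ 𝔟` given by an element killed by `𝔟`. -/
noncomputable def homOfTorsion (𝔟 : Ideal R) (i : ℕ) :
    torsionByComplex (injTerm I) 𝔟 i →ₗ[R] (ModuleCat.of R (R ⧸ 𝔟) ⟶ I.cocomplex.X i) where
  toFun z := ModuleCat.ofHom (Submodule.liftQ 𝔟 (LinearMap.toSpanSingleton R (injTerm I i) z)
    fun c hc => mem_torsionBySet_ideal.1 z.2 c hc)
  map_add' y z := ModuleCat.hom_ext <| Submodule.linearMap_qext _ <| LinearMap.ext_ring <| by
    change (1 : R) • (y + z : injTerm I i) = (1 : R) • (y : injTerm I i) + (1 : R) • z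
    rw [smul_add]
  map_smul' r z := ModuleCat.hom_ext <| Submodule.linearMap_qext _ <| LinearMap.ext_ring <| by
    change (1 : R) • (r • z : injTerm I i) = r • (1 : R) • (z : injTerm I i)
    rw [smul_comm]

lemma homOfTorsion_one {𝔟 : Ideal R} {i : ℕ} (z : torsionByComplex (injTerm I) 𝔟 i) :
    homOfTorsion I 𝔟 i z (Submodule.Quotient.mk (1 : R)) = (z : injTerm I i) :=
  one_smul R (z : injTerm I i)

variable {I} in
lemma hom_quotient_ext {𝔟 : Ideal R} {N : ModuleCat.{u} R} {f g : ModuleCat.of R (R ⧸ 𝔟) ⟶ N}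
    (h : f (Submodule.Quotient.mk (1 : R)) = g (Submodule.Quotient.mk (1 : R))) : f = g := by
  refine ModuleCat.hom_ext (LinearMap.ext fun x => ?_)
  obtain ⟨r, rfl⟩ := Submodule.Quotient.mk_surjective _ x
  have : (Submodule.Quotient.mk r : R ⧸ 𝔟) = r • Submodule.Quotient.mk (1 : R) := by
    rw [← Submodule.Quotient.mk_smul, smul_eq_mul, mul_one]
  rw [this]
  exact (map_smul f.hom r _).trans ((congrArg (r • ·) h).trans (map_smul g.hom r _).symm)

lemma exists_homOfTorsion_eq {𝔟 : Ideal R} {i : ℕ} (f : ModuleCat.of R (R ⧸ 𝔟) ⟶ I.cocomplex.X i) :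
    ∃ z, homOfTorsion I 𝔟 i z = f := by
  refine ⟨⟨f (Submodule.Quotient.mk (1 : R)), mem_torsionBySet_ideal.2 fun c hc => ?_⟩, ?_⟩
  · refine (map_smul f.hom c _).symm.trans ?_
    rw [← Submodule.Quotient.mk_smul, smul_eq_mul, mul_one, (Submodule.Quotient.mk_eq_zero _).2 hc]
    exact map_zero f.hom
  · exact hom_quotient_ext (homOfTorsion_one I _)

lemma homOfTorsion_comp_d {𝔟 : Ideal R} {i : ℕ} (z : torsionByComplex (injTerm I) 𝔟 i) :
    homOfTorsion I 𝔟 i z ≫ I.cocomplex.d i (i + 1) =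
      homOfTorsion I 𝔟 (i + 1) ⟨injDiff I i z, map_mem_torsionBySet _ z.2⟩ := by
  refine hom_quotient_ext ?_
  rw [homOfTorsion_one]
  exact congrArg (injDiff I i) (homOfTorsion_one I z)

/-- The morphism from `R ⧸ 𝔟` given by a cocycle of `(0 :_I 𝔟)`. -/
noncomputable def homOfCocycles (𝔟 : Ideal R) (i : ℕ) :
    cocycles (injDiff I) (torsionByComplex (injTerm I) 𝔟) i →ₗ[R]
      (ModuleCat.of R (R ⧸ 𝔟) ⟶ I.cocomplex.X i) :=
  homOfTorsion I 𝔟 i ∘ₗ Submodule.inclusion inf_le_left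

lemma homOfCocycles_one {𝔟 : Ideal R} {i : ℕ}
    (z : cocycles (injDiff I) (torsionByComplex (injTerm I) 𝔟) i) :
    homOfCocycles I 𝔟 i z (Submodule.Quotient.mk (1 : R)) = (z : injTerm I i) :=
  homOfTorsion_one I _

lemma homOfCocycles_comp_d {𝔟 : Ideal R} {i : ℕ}
    (z : cocycles (injDiff I) (torsionByComplex (injTerm I) 𝔟) i) :
    homOfCocycles I 𝔟 i z ≫ I.cocomplex.d i (i + 1) = 0 :=
  (homOfTorsion_comp_d I _).trans (hom_quotient_ext ((homOfTorsion_one I _).trans z.2.2))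

lemma injective_extMk_smul {X : ModuleCat.{u} R} {n : ℕ}
    (r : R) (f : X ⟶ I.cocomplex.X n) (hf : f ≫ I.cocomplex.d n (n + 1) = 0) :
    I.extMk (r • f) (n + 1) rfl (by rw [Linear.smul_comp, hf, smul_zero]) =
      r • I.extMk f (n + 1) rfl hf := by
  have h : r • I.extMk f (n + 1) rfl hf =
      (Ext.mk₀ (r • 𝟙 X)).comp (I.extMk f (n + 1) rfl hf) (zero_add n) := by
    rw [Ext.mk₀_smul, Ext.smul_comp, Ext.mk₀_id_comp]
  rw [h, I.mk₀_comp_extMk]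
  simp only [Linear.smul_comp, Category.id_comp]

/-- The class in `Ext^i(R ⧸ 𝔟, M)` of a cocycle of `(0 :_I 𝔟)`. -/
noncomputable def extOfCocycles (𝔟 : Ideal R) (i : ℕ) :
    cocycles (injDiff I) (torsionByComplex (injTerm I) 𝔟) i →ₗ[R]
      Abelian.Ext (ModuleCat.of R (R ⧸ 𝔟)) M i where
  toFun z := I.extMk (homOfCocycles I 𝔟 i z) (i + 1) rfl (homOfCocycles_comp_d I z)
  map_add' y z := by
    rw [I.add_extMk]
    simp only [map_add]
  map_smul' r z := by
    rw [RingHom.id_apply, ← injective_extMk_smul]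
    simp only [map_smul]

lemma extOfCocycles_apply {𝔟 : Ideal R} {i : ℕ}
    (z : cocycles (injDiff I) (torsionByComplex (injTerm I) 𝔟) i) : extOfCocycles I 𝔟 i z =
      I.extMk (homOfCocycles I 𝔟 i z) (i + 1) rfl (homOfCocycles_comp_d I z) := rfl

lemma extOfCocycles_surjective (𝔟 : Ideal R) (i : ℕ) :
    Function.Surjective (extOfCocycles I 𝔟 i) := by
  intro α
  obtain ⟨f, hf, rfl⟩ := I.extMk_surjective α (i + 1) rfl
  obtain ⟨z, rfl⟩ := exists_homOfTorsion_eq I f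
  refine ⟨⟨z, z.2, ?_⟩, rfl⟩
  rw [homOfTorsion_comp_d] at hf
  exact (homOfTorsion_one I _).symm.trans congr($hf (Submodule.Quotient.mk (1 : R)))

lemma extOfCocycles_eq_zero_iff (𝔟 : Ideal R) (i : ℕ)
    (z : cocycles (injDiff I) (torsionByComplex (injTerm I) 𝔟) i) :
    extOfCocycles I 𝔟 i z = 0 ↔
      (z : injTerm I i) ∈ coboundaries (injDiff I) (torsionByComplex (injTerm I) 𝔟) i := by
  rw [extOfCocycles_apply]
  cases i with
  | zero =>
    rw [I.extMk_eq_zero_iff_of_zero]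
    refine ⟨fun h => (Submodule.mem_bot R).2 ?_, fun h => ?_⟩
    · exact (homOfTorsion_one I _).symm.trans congr($h (Submodule.Quotient.mk (1 : R)))
    · exact hom_quotient_ext ((homOfTorsion_one I _).trans ((Submodule.mem_bot R).1 h))
  | succ i =>
    rw [I.extMk_eq_zero_iff _ _ _ _ i rfl]
    constructor
    · rintro ⟨g, hg⟩
      obtain ⟨w, rfl⟩ := exists_homOfTorsion_eq I g
      refine ⟨w, w.2, ?_⟩
      rw [homOfTorsion_comp_d] at hg
      exact (homOfTorsion_one I _).symm.trans
        (congr($hg (Submodule.Quotient.mk (1 : R))).trans (homOfCocycles_one I _))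
    · rintro ⟨w, hw, hwz⟩
      refine ⟨homOfTorsion I 𝔟 i ⟨w, hw⟩, ?_⟩
      rw [homOfTorsion_comp_d]
      exact hom_quotient_ext ((homOfTorsion_one I _).trans
        (hwz.trans (homOfCocycles_one I _).symm))

/-- The morphism `R ⧸ 𝔟 ⟶ R ⧸ 𝔠` for `𝔟 ≤ 𝔠`. -/
abbrev quotientMap {𝔟 𝔠 : Ideal R} (h : 𝔟 ≤ 𝔠) :
    ModuleCat.of R (R ⧸ 𝔟) ⟶ ModuleCat.of R (R ⧸ 𝔠) :=
  ModuleCat.ofHom (Submodule.mapQ _ _ LinearMap.id h)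

lemma mk₀_comp_extOfCocycles {𝔟 𝔠 : Ideal R} (h : 𝔟 ≤ 𝔠) (i : ℕ)
    (z : cocycles (injDiff I) (torsionByComplex (injTerm I) 𝔠) i) :
    (Ext.mk₀ (quotientMap h)).comp (extOfCocycles I 𝔠 i z) (zero_add i) =
      extOfCocycles I 𝔟 i ⟨z, torsionBySet_anti h z.2.1, z.2.2⟩ := by
  rw [extOfCocycles_apply, extOfCocycles_apply, I.mk₀_comp_extMk]
  congr 1
  refine hom_quotient_ext (Eq.trans ?_ (homOfCocycles_one I _).symm)
  exact homOfCocycles_one I z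

/-- `Ext^i(R ⧸ 𝔟, M)` is the cohomology of `(0 :_I 𝔟)`. -/
lemma exists_linearEquiv_cohomology_ext (𝔟 : Ideal R) (i : ℕ) :
    ∃ e : Cohomology (injDiff I) (torsionByComplex (injTerm I) 𝔟) i ≃ₗ[R]
        Abelian.Ext (ModuleCat.of R (R ⧸ 𝔟)) M i,
      ∀ z, e (Submodule.Quotient.mk z) = extOfCocycles I 𝔟 i z :=
  exists_linearEquiv_of_ker_eq (f := Submodule.mkQ _) (Submodule.mkQ_surjective _)
    (extOfCocycles_surjective I 𝔟 i) <| Submodule.ext fun z => by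
      rw [LinearMap.mem_ker, LinearMap.mem_ker, extOfCocycles_eq_zero_iff]
      exact mk_eq_zero_iff_mem_coboundaries z.2

end InjectiveSide

section Colimit

open CategoryTheory.Abelian

variable {R : Type u} [CommRing R] {M : ModuleCat.{u} R} (I : InjectiveResolution M)

/-- `H^i_𝔞(M)` is the cohomology of `Γ_𝔞(I)`. -/
lemma nonempty_localCohomology_linearEquiv (𝔞 : Ideal R) (i : ℕ) :
    Nonempty ((localCohomology 𝔞 i).obj M ≃ₗ[R]
      Cohomology (injDiff I) (powTorsionComplex (injTerm I) 𝔞) i) := by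
  obtain ⟨e, he⟩ := exists_natural_linearEquiv_ext M i
  choose e' he' using fun n : ℕ => exists_linearEquiv_cohomology_ext I (𝔞 ^ n) i
  have hle (n i : ℕ) : torsionByComplex (injTerm I) (𝔞 ^ n) i ≤
      powTorsionComplex (injTerm I) 𝔞 i := torsionBySet_pow_le_powTorsion 𝔞 n
  let D := localCohomology.diagram (localCohomology.idealPowersDiagram 𝔞) i ⋙
    (evaluation (ModuleCat.{u} R) (ModuleCat.{u} R)).obj M
  let e'' (n : ℕ) : D.obj (.op (.op n)) ≃ₗ[R]
      Abelian.Ext (ModuleCat.of R (R ⧸ 𝔞 ^ n)) M i := e (ModuleCat.of R (R ⧸ 𝔞 ^ n))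
  let q (n : ℕ) : D.obj (.op (.op n)) ≃ₗ[R]
      Cohomology (injDiff I) (torsionByComplex (injTerm I) (𝔞 ^ n)) i :=
    e'' n ≪≫ₗ (e' n).symm
  have hq₀ (n : ℕ) (u) : e' n (q n u) = e'' n u := LinearEquiv.apply_symm_apply _ _
  have hq {m n : ℕ} (h : m ≤ n) (f : (.op (.op m) : (ℕᵒᵖ)ᵒᵖ) ⟶ .op (.op n)) (u) :
      q n (D.map f u) =
        cohomologyMap (fun j => torsionBySet_anti (Ideal.pow_le_pow_right h)) i (q m u) := by
    obtain ⟨z, hz⟩ := Submodule.Quotient.mk_surjective _ (q m u)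
    have h1 : e'' m u = extOfCocycles I (𝔞 ^ m) i z := by rw [← he', hz, hq₀]
    have h2 : e'' n (D.map f u) = (Ext.mk₀ (quotientMap (Ideal.pow_le_pow_right h))).comp
        (e'' m u) (zero_add i) :=
      he _ _ (quotientMap (Ideal.pow_le_pow_right h)) u
    apply (e' n).injective
    rw [hq₀, h2, h1, mk₀_comp_extOfCocycles, ← hz]
    exact (he' n _).symm
  let c : Limits.Cocone D :=
    { pt := ModuleCat.of R (Cohomology (injDiff I) (powTorsionComplex (injTerm I) 𝔞) i)
      ι :=
        { app := fun j => ModuleCat.ofHom (cohomologyMap (hle j.unop.unop) i ∘ₗ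
            (q j.unop.unop).toLinearMap)
          naturality := fun j k f => by
            refine ModuleCat.hom_ext (LinearMap.ext fun u => ?_)
            have h1 := congrArg (cohomologyMap (hle k.unop.unop) i) (hq f.unop.unop.le f u)
            refine h1.trans ?_
            obtain ⟨z, hz⟩ := Submodule.Quotient.mk_surjective _ (q j.unop.unop u)
            change _ = cohomologyMap (hle j.unop.unop) i (q j.unop.unop u)
            rw [← hz]
            rfl } }
  let φ : Limits.colimit D ⟶ c.pt := Limits.colimit.desc D c
  have hφ (n : ℕ) (u : D.obj (.op (.op n))) :
      φ (Limits.colimit.ι D (.op (.op n)) u) = cohomologyMap (hle n) i (q n u) :=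
    congr($(Limits.colimit.ι_desc c (.op (.op n))) u)
  have hsurj : Function.Surjective φ.hom := by
    intro x
    obtain ⟨⟨z, hz⟩, rfl⟩ := Submodule.Quotient.mk_surjective _ x
    obtain ⟨n, hn⟩ := hz.1
    exact ⟨Limits.colimit.ι D (.op (.op n)) ((q n).symm (Submodule.Quotient.mk ⟨z, hn, hz.2⟩)),
      (hφ n _).trans (by rw [LinearEquiv.apply_symm_apply]; rfl)⟩
  have : Limits.PreservesFilteredColimitsOfSize.{0, 0} (forget (ModuleCat.{u} R)) :=
    Limits.preservesFilteredColimitsOfSize_shrink.{0, u, 0, u} _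
  have hinj : Function.Injective φ.hom := by
    rw [injective_iff_map_eq_zero]
    intro x hx
    obtain ⟨⟨⟨n⟩⟩, u, rfl⟩ := Limits.Concrete.colimit_exists_rep D x
    obtain ⟨⟨z, hz⟩, hzu⟩ := Submodule.Quotient.mk_surjective _ (q n u)
    have h1 : z ∈ coboundaries (injDiff I) (powTorsionComplex (injTerm I) 𝔞) i := by
      rw [← mk_eq_zero_iff_mem_coboundaries (cocycles_mono (hle n) i hz)]
      refine Eq.trans ?_ ((hφ n u).symm.trans hx)
      rw [← hzu]
      rfl
    obtain ⟨m, hm, h2⟩ : ∃ m ≥ n,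
        z ∈ coboundaries (injDiff I) (torsionByComplex (injTerm I) (𝔞 ^ m)) i := by
      cases i with
      | zero => exact ⟨n, le_rfl, h1⟩
      | succ i =>
        obtain ⟨w, ⟨k, hk⟩, hw⟩ := h1
        exact ⟨max n k, le_max_left _ _, w,
          torsionBySet_anti (Ideal.pow_le_pow_right (le_max_right n k)) hk, hw⟩
    let f : (.op (.op n) : (ℕᵒᵖ)ᵒᵖ) ⟶ .op (.op m) := (homOfLE hm).op.op
    have h3 : D.map f u = 0 := by
      apply (q m).injective
      rw [hq hm f u, ← hzu, map_zero]
      exact (mk_eq_zero_iff_mem_coboundaries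
        (cocycles_mono (fun j => torsionBySet_anti (Ideal.pow_le_pow_right hm)) i hz)).2 h2
    have h4 : Limits.colimit.ι D (.op (.op m)) (D.map f u) =
        Limits.colimit.ι D (.op (.op n)) u := congr($(Limits.colimit.w D f) u)
    refine h4.symm.trans ?_
    rw [h3]
    exact map_zero (Limits.colimit.ι D (.op (.op m))).hom
  exact ⟨(Limits.colimitObjIsoColimitCompEvaluation _ M).toLinearEquiv ≪≫ₗ
    LinearEquiv.ofBijective φ.hom ⟨hinj, hsurj⟩⟩

/-- Local cohomology of `M` with respect to all ideals, and `Ext` of cyclic modules into `M`, are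
computed by one complex of injective modules. -/
theorem exists_injective_complex (M : Type u) [AddCommGroup M] [Module R M] :
    ∃ (E : ℕ → Type u) (_ : ∀ i, AddCommGroup (E i)) (_ : ∀ i, Module R (E i))
      (d : ∀ i, E i →ₗ[R] E (i + 1)),
      (∀ i w, d (i + 1) (d i w) = 0) ∧ (∀ i, Module.Injective R (E i)) ∧
      (∀ (𝔞 : Ideal R) (i : ℕ), Nonempty (LocalCohomologyModule 𝔞 i M ≃ₗ[R]
        Cohomology d (powTorsionComplex E 𝔞) i)) ∧
      (∀ (𝔟 : Ideal R) (i : ℕ), Nonempty (Abelian.Ext (ModuleCat.of R (R ⧸ 𝔟)) (ModuleCat.of R M) i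
        ≃ₗ[R] Cohomology d (torsionByComplex E 𝔟) i)) := by
  let I : InjectiveResolution (ModuleCat.of R M) := InjectiveResolution.of _
  exact ⟨injTerm I, inferInstance, inferInstance, injDiff I, injDiff_injDiff I,
    injective_injTerm I, nonempty_localCohomology_linearEquiv I,
    fun 𝔟 i => ⟨(exists_linearEquiv_cohomology_ext I 𝔟 i).choose.symm⟩⟩

lemma nonempty_extModule_linearEquiv (N M : Type u) [AddCommGroup N] [Module R N]
    [AddCommGroup M] [Module R M] (i : ℕ) : Nonempty (ExtModule R i N M ≃ₗ[R]
      Abelian.Ext (ModuleCat.of R N) (ModuleCat.of R M) i) :=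
  ⟨(exists_natural_linearEquiv_ext (ModuleCat.of R M) i).choose (ModuleCat.of R N)⟩

end Colimit

/-! ### Filter regular sequences -/

section FilterRegular

open Pointwise IsLocalRing

variable {R : Type u} [CommRing R] [IsLocalRing R]

lemma isFilterRegularIn_nil (𝔞 : Ideal R) (M : Type u) [AddCommGroup M] [Module R M] :
    IsFilterRegularIn 𝔞 M [] :=
  ⟨by simp, by simp⟩

lemma isFilterRegularIn_cons_iff {𝔞 : Ideal R} {M : Type u} [AddCommGroup M] [Module R M]
    {x : R} {xs : List R} :
    IsFilterRegularIn 𝔞 M (x :: xs) ↔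
      x ∈ 𝔞 ∧ (∀ p ∈ associatedPrimes R M, p ≠ maximalIdeal R → x ∉ p) ∧
        IsFilterRegularIn 𝔞 (QuotSMulTop x M) xs := by
  have h₀ : (Ideal.ofList ([] : List R) • ⊤ : Submodule R M) = ⊥ := by simp
  let e₀ := Submodule.quotEquivOfEqBot _ h₀
  let e (i : ℕ) := Submodule.quotOfListConsSMulTopEquivQuotSMulTopInner M x (xs.take i)
  constructor
  · rintro ⟨hmem, h⟩
    refine ⟨hmem x (by simp), fun p hp => h 0 (by simp) p (e₀.isAssociatedPrime_iff.mpr hp),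
      fun y hy => hmem y (by simp [hy]), fun i hi p hp => ?_⟩
    exact h (i + 1) (by simpa using hi) p ((e i).isAssociatedPrime_iff.mpr hp)
  · rintro ⟨hx, h, hmem, h'⟩
    refine ⟨by simpa using ⟨hx, hmem⟩, fun i hi p hp => ?_⟩
    match i with
    | 0 => exact h p (e₀.isAssociatedPrime_iff.mp hp)
    | i + 1 => exact h' i (by simpa using hi) p ((e i).isAssociatedPrime_iff.mp hp)

variable [IsNoetherianRing R]

/-- If `x` avoids the associated primes of `M` other than `𝔪`, then all associated primes of
the kernel of multiplication by `x` are equal to `𝔪`, so that each element of the kernel is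
killed by a power of each `s ∈ 𝔪`. -/
lemma exists_pow_smul_eq_zero_of_smul_eq_zero {M : Type u} [AddCommGroup M] [Module R M]
    {x s : R} (hx : ∀ p ∈ associatedPrimes R M, p ≠ maximalIdeal R → x ∉ p)
    (hs : s ∈ maximalIdeal R) {w : M} (hw : x • w = 0) : ∃ k : ℕ, s ^ k • w = 0 := by
  by_contra! hne
  -- The annihilators of the `s ^ k • w` increase; let `k` be a place where they become constant.
  let f : ℕ →o Ideal R := ⟨fun k => (⊥ : Submodule R M).colon {s ^ k • w},
    monotone_nat_of_le_succ fun k y hy => by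
      rw [Submodule.mem_colon_singleton, Submodule.mem_bot] at hy ⊢
      rw [pow_succ', mul_smul, smul_comm, hy, smul_zero]⟩
  obtain ⟨k, hk⟩ := monotone_stabilizes_iff_noetherian.mpr inferInstance f
  let W := Submodule.span R {s ^ k • w}
  have hwW : s ^ k • w ∈ W := Submodule.mem_span_singleton_self _
  obtain ⟨P, hP, -⟩ := exists_le_isAssociatedPrime_of_isNoetherianRing R (⟨_, hwW⟩ : W)
    (fun h => hne k (congrArg Subtype.val h))
  have hPM : IsAssociatedPrime P M := hP.map_of_injective W.subtype W.subtype_injective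
  obtain ⟨hprime, ⟨v, hv⟩, hPv⟩ := isAssociatedPrime_iff.mp hP
  obtain ⟨r, rfl⟩ := Submodule.mem_span_singleton.mp hv
  have hmem (y : R) : y ∈ P ↔ y • r • s ^ k • w = 0 := by
    rw [hPv, Submodule.mem_colon_singleton, Submodule.mem_bot, Subtype.ext_iff]
    rfl
  have hsP : s ∉ P := fun h => by
    have h₁ : r ∈ f (k + 1) := by
      refine Submodule.mem_colon_singleton.mpr ((Submodule.mem_bot R).mpr ?_)
      rw [pow_succ', mul_smul, smul_comm]
      exact (hmem s).mp h
    rw [← hk (k + 1) k.le_succ] at h₁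
    refine hprime.ne_top ((Ideal.eq_top_iff_one P).mpr ((hmem 1).mpr ?_))
    rw [one_smul]
    exact (Submodule.mem_bot R).mp (Submodule.mem_colon_singleton.mp h₁)
  have hxP : x ∈ P := by
    rw [hmem, smul_comm x r, smul_comm x, hw, smul_zero, smul_zero]
  exact hx P hPM (fun h => hsP (h ▸ hs)) hxP

/-- A uniform version of `exists_pow_smul_eq_zero_of_smul_eq_zero`. -/
lemma exists_forall_pow_smul_eq_zero_of_smul_eq_zero {M : Type u} [AddCommGroup M] [Module R M]
    [Module.Finite R M] {x s : R}
    (hx : ∀ p ∈ associatedPrimes R M, p ≠ maximalIdeal R → x ∉ p)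
    (hs : s ∈ maximalIdeal R) : ∃ k : ℕ, ∀ w : M, x • w = 0 → s ^ k • w = 0 := by
  obtain ⟨S, hS⟩ := IsNoetherian.noetherian (LinearMap.ker (LinearMap.lsmul R M x))
  have hmem (w : S) : x • (w : M) = 0 := by
    have : (w : M) ∈ LinearMap.ker (LinearMap.lsmul R M x) := hS ▸ Submodule.subset_span w.2
    simpa using this
  choose k hk using fun w : S => exists_pow_smul_eq_zero_of_smul_eq_zero hx hs (hmem w)
  refine ⟨Finset.univ.sup k, fun w hw => ?_⟩
  have hle : LinearMap.ker (LinearMap.lsmul R M x) ≤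
      LinearMap.ker (LinearMap.lsmul R M (s ^ Finset.univ.sup k)) := by
    rw [← hS, Submodule.span_le]
    intro v hv
    obtain ⟨j, hj⟩ := Nat.exists_eq_add_of_le (Finset.le_sup (f := k) (Finset.mem_univ ⟨v, hv⟩))
    rw [hj, SetLike.mem_coe, LinearMap.mem_ker, LinearMap.lsmul_apply, pow_add, mul_comm, mul_smul,
      hk ⟨v, hv⟩, smul_zero]
  simpa using hle (show w ∈ _ by simpa using hw)

end FilterRegular

/-! ### `Ext` modules and filter regular sequences -/

section Ext

open CategoryTheory.Abelian IsLocalRing Pointwise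

variable {R : Type u} [CommRing R]

/-- The long exact sequences of `0 → ker x → M → xM → 0` and `0 → xM → M → M/xM → 0`: if the kernel
of `x` on `M` and `Ext^{i-1}(N, M/xM)` are `s`-power torsion, the former uniformly, then so is the
kernel of `x` on `Ext^i(N, M)`. -/
lemma exists_pow_smul_ext_eq_zero_of_smul_eq_zero {N M : Type u} [AddCommGroup N] [Module R N]
    [AddCommGroup M] [Module R M] (x : R) (i : ℕ)
    (α : Ext (ModuleCat.of R N) (ModuleCat.of R M) i) (hα : x • α = 0) {s : R}
    (hK : ∃ k : ℕ, ∀ w : M, x • w = 0 → s ^ k • w = 0)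
    (hi : ∀ j, j + 1 = i → ∀ δ : Ext (ModuleCat.of R N) (ModuleCat.of R (QuotSMulTop x M)) j,
      ∃ k : ℕ, s ^ k • δ = 0) : ∃ k : ℕ, s ^ k • α = 0 := by
  let I : Submodule R M := x • ⊤
  let K : Submodule R M := LinearMap.ker (LinearMap.lsmul R M x)
  let π : M →ₗ[R] I := (LinearMap.lsmul R M x).codRestrict I
    fun m => Submodule.smul_mem_pointwise_smul m x ⊤ trivial
  have hπ : Function.Surjective π := by
    rintro ⟨y, hy⟩
    obtain ⟨m, -, rfl⟩ := Submodule.mem_smul_pointwise_iff_exists _ _ _ |>.mp hy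
    exact ⟨m, rfl⟩
  have e₁ : Function.Exact K.subtype π := fun m => by
    rw [Subtype.ext_iff, Submodule.coe_subtype, Subtype.range_coe]
    rfl
  have e₂ : Function.Exact I.subtype I.mkQ := LinearMap.exact_subtype_mkQ I
  let S₁ := ModuleCat.shortComplexOfCompEqZero K.subtype π e₁.linearMap_comp_eq_zero
  let S₂ := ModuleCat.shortComplexOfCompEqZero I.subtype I.mkQ e₂.linearMap_comp_eq_zero
  have hS₁ : S₁.ShortExact := ModuleCat.shortComplex_shortExact S₁ e₁ K.subtype_injective hπ
  have hS₂ : S₂.ShortExact :=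
    ModuleCat.shortComplex_shortExact S₂ e₂ I.subtype_injective I.mkQ_surjective
  have hcomp : S₁.g ≫ S₂.f = x • 𝟙 (ModuleCat.of R M) := rfl
  have h₁ : (α.comp (Ext.mk₀ S₁.g) (add_zero i)).comp (Ext.mk₀ S₂.f) (add_zero i) = 0 := by
    rw [Ext.comp_assoc_of_third_deg_zero, Ext.mk₀_comp_mk₀, hcomp, ← Ext.smul_eq_comp_mk₀, hα]
  have h₂ : ∃ l : ℕ, s ^ l • α.comp (Ext.mk₀ S₁.g) (add_zero i) = 0 := by
    match i, hi with
    | 0, _ =>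
      have := hS₂.mono_f
      refine ⟨0, ?_⟩
      rw [(injective_iff_map_eq_zero _).mp
        (Ext.postcomp_mk₀_injective_of_mono (ModuleCat.of R N) S₂.f) _ h₁, smul_zero]
    | j + 1, hi =>
      obtain ⟨δ, hδ⟩ := Ext.covariant_sequence_exact₁ _ hS₂ _ h₁ rfl
      obtain ⟨l, hl⟩ := hi j rfl δ
      exact ⟨l, by rw [← hδ, ← Ext.smul_comp, hl, Ext.zero_comp]⟩
  obtain ⟨k, hk⟩ := hK
  obtain ⟨l, hl⟩ := h₂
  obtain ⟨γ, hγ⟩ := Ext.covariant_sequence_exact₂ _ hS₁ (s ^ l • α) (by rw [Ext.smul_comp, hl])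
  have hzero : s ^ k • 𝟙 S₁.X₁ = 0 := by
    ext w
    exact hk w.1 w.2
  refine ⟨k + l, ?_⟩
  rw [pow_add, mul_smul, ← hγ, ← Ext.smul_comp, Ext.smul_eq_comp_mk₀ γ, hzero, Ext.mk₀_zero,
    Ext.comp_zero, Ext.zero_comp]

lemma smul_ext_eq_zero {N M : ModuleCat.{u} R} {i : ℕ} {t : R} (ht : t ∈ Module.annihilator R N)
    (α : Ext N M i) : t • α = 0 := by
  have h := congrArg (fun f => f.hom α) (Ext.postcomp_smul_id_eq_zero_of_mem_annihilator
    (M := M) ht i)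
  simpa [← Ext.smul_eq_comp_mk₀] using h

lemma subsingleton_linearMap_of_subsingleton_ext {N M : Type u} [AddCommGroup N] [Module R N]
    [AddCommGroup M] [Module R M]
    (h : Subsingleton (Ext (ModuleCat.of R N) (ModuleCat.of R M) 0)) :
    Subsingleton (N →ₗ[R] M) :=
  (Ext.addEquiv₀.trans ModuleCat.homAddEquiv :
    Ext (ModuleCat.of R N) (ModuleCat.of R M) 0 ≃+ (N →ₗ[R] M)).symm.subsingleton

lemma subsingleton_ext_quotSMulTop {N M : Type u} [AddCommGroup N] [Module R N] [AddCommGroup M]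
    [Module R M] {x : R} (hx : IsSMulRegular M x) {i : ℕ}
    (h₀ : Subsingleton (Ext (ModuleCat.of R N) (ModuleCat.of R M) i))
    (h₁ : Subsingleton (Ext (ModuleCat.of R N) (ModuleCat.of R M) (i + 1))) :
    Subsingleton (Ext (ModuleCat.of R N) (ModuleCat.of R (QuotSMulTop x M)) i) := by
  have z₀ := AddCommGrpCat.isZero_of_iff_subsingleton.mpr h₀
  have z₁ := AddCommGrpCat.isZero_of_iff_subsingleton.mpr h₁
  exact AddCommGrpCat.subsingleton_of_isZero <| ShortComplex.Exact.isZero_of_both_zeros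
    (Ext.covariant_sequence_exact₃' _
      (IsSMulRegular.smulShortComplex_shortExact (M := ModuleCat.of R M) hx)
      i (i + 1) rfl)
    (z₀.eq_zero_of_src _) (z₁.eq_zero_of_tgt _)

lemma isSMulRegular_iff_forall_associatedPrimes [IsNoetherianRing R] {M : Type u}
    [AddCommGroup M] [Module R M] {x : R} : IsSMulRegular M x ↔ ∀ p ∈ associatedPrimes R M, x ∉ p := by
  have h := Set.ext_iff.mp (biUnion_associatedPrimes_eq_compl_regular R M) x
  rw [Set.mem_iUnion₂] at h
  simpa using not_congr h.symm

variable [IsLocalRing R] [IsNoetherianRing R]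

/-- An `M`-filter regular sequence in `𝔞` of length `n` makes `Ext^i(N, M)` an `𝔪`-torsion module
for `i < n`, whenever each element of `𝔞` acts nilpotently on `N`. -/
lemma exists_pow_smul_ext_eq_zero_of_isFilterRegularIn {𝔞 : Ideal R} {xs : List R}
    {M : Type u} [AddCommGroup M] [Module R M] [Module.Finite R M]
    (hxs : IsFilterRegularIn 𝔞 M xs) {N : Type u} [AddCommGroup N] [Module R N]
    (hN : ∀ x ∈ 𝔞, ∃ k : ℕ, x ^ k ∈ Module.annihilator R N) {s : R} (hs : s ∈ maximalIdeal R)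
    {i : ℕ} (hi : i < xs.length) (α : Ext (ModuleCat.of R N) (ModuleCat.of R M) i) :
    ∃ k : ℕ, s ^ k • α = 0 := by
  induction xs generalizing M i with
  | nil => simp at hi
  | cons x xs ih =>
    obtain ⟨hx, hass, hxs⟩ := isFilterRegularIn_cons_iff.mp hxs
    have key (m : ℕ) (β : Ext (ModuleCat.of R N) (ModuleCat.of R M) i) (hβ : x ^ m • β = 0) :
        ∃ k : ℕ, s ^ k • β = 0 := by
      induction m generalizing β with
      | zero => exact ⟨0, by simpa using hβ⟩
      | succ m ihm =>
        obtain ⟨j, hj⟩ := ihm (x • β) (by rwa [← mul_smul, ← pow_succ])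
        obtain ⟨k, hk⟩ := exists_pow_smul_ext_eq_zero_of_smul_eq_zero x i (s ^ j • β)
          (by rw [smul_comm, hj]) (exists_forall_pow_smul_eq_zero_of_smul_eq_zero hass hs)
          fun i' hi' δ => ih hxs (by simp only [List.length_cons] at hi; omega) δ
        exact ⟨k + j, by rw [pow_add, mul_smul, hk]⟩
    obtain ⟨m, hm⟩ := hN x hx
    exact key m α (smul_ext_eq_zero hm α)

/-- A short filter regular sequence can be extended by an element that is regular on the
quotient, provided that enough modules `Ext^i(R/𝔞, M)` and `Ext^i(R/𝔪, M)` vanish. -/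
lemma exists_isFilterRegularIn_append {𝔞 : Ideal R} {xs : List R}
    {M : Type u} [AddCommGroup M] [Module R M] [Module.Finite R M]
    (hxs : IsFilterRegularIn 𝔞 M xs)
    (h𝔞 : ∀ i ≤ xs.length, Subsingleton (Ext (ModuleCat.of R (R ⧸ 𝔞)) (ModuleCat.of R M) i))
    (h𝔪 : ∀ i ≤ xs.length,
      Subsingleton (Ext (ModuleCat.of R (R ⧸ maximalIdeal R)) (ModuleCat.of R M) i)) :
    ∃ y, IsFilterRegularIn 𝔞 M (xs ++ [y]) := by
  induction xs generalizing M with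
  | nil =>
    obtain ⟨y, hy, hreg⟩ := IsSMulRegular.subsingleton_linearMap_iff.mp
      (subsingleton_linearMap_of_subsingleton_ext (h𝔞 0 le_rfl))
    rw [Ideal.annihilator_quotient] at hy
    exact ⟨y, isFilterRegularIn_cons_iff.mpr ⟨hy, fun p hp _ =>
      isSMulRegular_iff_forall_associatedPrimes.mp hreg p hp, isFilterRegularIn_nil _ _⟩⟩
  | cons x xs ih =>
    obtain ⟨hx, hass, hxs⟩ := isFilterRegularIn_cons_iff.mp hxs
    have hnot : maximalIdeal R ∉ associatedPrimes R M := fun h => by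
      obtain ⟨-, f, hf⟩ := (isAssociatedPrime_iff_exists_injective_linearMap _ _).mp h
      have := subsingleton_linearMap_of_subsingleton_ext (h𝔪 0 (Nat.zero_le _))
      exact one_ne_zero (hf (by rw [Subsingleton.elim f 0]; rfl : f 1 = f 0))
    have hreg : IsSMulRegular M x := isSMulRegular_iff_forall_associatedPrimes.mpr
      fun p hp => hass p hp fun h => hnot (h ▸ hp)
    obtain ⟨y, hy⟩ := ih hxs
      (fun i hi => subsingleton_ext_quotSMulTop hreg (h𝔞 i (by simp; omega))
        (h𝔞 (i + 1) (by simpa using hi)))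
      (fun i hi => subsingleton_ext_quotSMulTop hreg (h𝔪 i (by simp; omega))
        (h𝔪 (i + 1) (by simpa using hi)))
    exact ⟨y, isFilterRegularIn_cons_iff.mpr ⟨hx, hass, hy⟩⟩

end Ext

/-! ### Local cohomology modules in terms of the complex of injectives -/

section Transfer

open IsLocalRing

variable {R : Type u} [CommRing R]

section Cohomology

variable {E : ℕ → Type u} [∀ i, AddCommGroup (E i)] [∀ i, Module R (E i)]
  {d : ∀ i, E i →ₗ[R] E (i + 1)} {K : ∀ i, Submodule R (E i)} {i : ℕ}
  {H : Type u} [AddCommGroup H] [Module R H]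

lemma mem_annihilator_iff_of_cohomology (e : H ≃ₗ[R] Cohomology d K i) {c : R} :
    c ∈ Module.annihilator R H ↔ ∀ z ∈ cocycles d K i, c • z ∈ coboundaries d K i := by
  rw [e.annihilator_eq, Module.mem_annihilator]
  refine ⟨fun h z hz => ?_, fun h u => ?_⟩
  · exact (mk_eq_zero_iff_mem_coboundaries (Submodule.smul_mem _ c hz)).mp
      (h (Submodule.Quotient.mk ⟨z, hz⟩))
  · obtain ⟨⟨z, hz⟩, rfl⟩ := Submodule.Quotient.mk_surjective _ u
    exact (mk_eq_zero_iff_mem_coboundaries (Submodule.smul_mem _ c hz)).mpr (h z hz)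

lemma subsingleton_iff_of_cohomology (e : H ≃ₗ[R] Cohomology d K i) :
    Subsingleton H ↔ cocycles d K i ≤ coboundaries d K i := by
  rw [← Module.annihilator_eq_top_iff (R := R), Ideal.eq_top_iff_one,
    mem_annihilator_iff_of_cohomology e]
  simp only [one_smul]
  rfl

lemma forall_exists_pow_smul_eq_zero_iff_of_cohomology (e : H ≃ₗ[R] Cohomology d K i) {x : R} :
    (∀ u : H, ∃ k : ℕ, x ^ k • u = 0) ↔
      ∀ z ∈ cocycles d K i, ∃ k : ℕ, x ^ k • z ∈ coboundaries d K i := by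
  refine ⟨fun h z hz => ?_, fun h u => ?_⟩
  · obtain ⟨k, hk⟩ := h (e.symm (Submodule.Quotient.mk ⟨z, hz⟩))
    rw [← map_smul, EmbeddingLike.map_eq_zero_iff] at hk
    exact ⟨k, (mk_eq_zero_iff_mem_coboundaries (Submodule.smul_mem _ _ hz)).mp hk⟩
  · obtain ⟨⟨z, hz⟩, hu⟩ := Submodule.Quotient.mk_surjective _ (e u)
    obtain ⟨k, hk⟩ := h z hz
    refine ⟨k, e.injective ?_⟩
    rw [map_smul, map_zero, ← hu]
    exact (mk_eq_zero_iff_mem_coboundaries (Submodule.smul_mem _ _ hz)).mpr hk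

end Cohomology

variable {M : Type u} [AddCommGroup M] [Module R M]

lemma subsingleton_ext_quotient_top (i : ℕ) :
    Subsingleton (Abelian.Ext (ModuleCat.of R (R ⧸ (⊤ : Ideal R))) (ModuleCat.of R M) i) := by
  refine subsingleton_of_forall_eq 0 fun α => ?_
  rw [← one_smul R α]
  exact smul_ext_eq_zero (by simp [Ideal.annihilator_quotient]) α

lemma nontrivial_extModule_iff {𝔟 : Ideal R} {i : ℕ} : Nontrivial (ExtModule R i (R ⧸ 𝔟) M) ↔
    Nontrivial (Abelian.Ext (ModuleCat.of R (R ⧸ 𝔟)) (ModuleCat.of R M) i) :=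
  (nonempty_extModule_linearEquiv (R ⧸ 𝔟) M i).some.toEquiv.nontrivial_congr

variable [IsNoetherianRing R]

/-- If a power of `c` kills `H^i_𝔞(M)` for `i < r` as well as `H^r_𝔫(M)`, and `H^r_𝔞(M)` is
`𝔫`-torsion, then a power of `c` kills `H^r_𝔞(M)`. -/
theorem mem_radical_annihilator_localCohomology {𝔞 𝔫 : Ideal R} (h𝔞 : 𝔞 ≤ 𝔫) {c : R} {r : ℕ}
    (hlow : ∀ i < r, c ∈ (Module.annihilator R (LocalCohomologyModule 𝔞 i M)).radical)
    (hmax : c ∈ (Module.annihilator R (LocalCohomologyModule 𝔫 r M)).radical)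
    (htors : ∀ x ∈ 𝔫, ∀ u : LocalCohomologyModule 𝔞 r M, ∃ k : ℕ, x ^ k • u = 0) :
    c ∈ (Module.annihilator R (LocalCohomologyModule 𝔞 r M)).radical := by
  obtain ⟨E, _, _, d, hd, hE, hH, -⟩ := exists_injective_complex (R := R) M
  have hrad (𝔟 : Ideal R) (i : ℕ) :
      c ∈ (Module.annihilator R (LocalCohomologyModule 𝔟 i M)).radical ↔
        ∃ N, ∀ z ∈ cocycles d (powTorsionComplex E 𝔟) i,
          c ^ N • z ∈ coboundaries d (powTorsionComplex E 𝔟) i :=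
    exists_congr fun N => mem_annihilator_iff_of_cohomology (hH 𝔟 i).some
  rw [hrad]
  exact exists_pow_smul_mem_coboundaries_of_torsion hd hE h𝔞 c r
    (fun i hi => (hrad 𝔞 i).mp (hlow i hi)) ((hrad 𝔫 r).mp hmax) fun x hx =>
    (forall_exists_pow_smul_eq_zero_iff_of_cohomology (hH 𝔞 r).some).mp (htors x hx)

theorem finite_localCohomology_of_le_radical_annihilator [Module.Finite R M] {𝔞 : Ideal R} {t : ℕ}
    (h : ∀ i < t, 𝔞 ≤ (Module.annihilator R (LocalCohomologyModule 𝔞 i M)).radical) :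
    ∀ i < t, Module.Finite R (LocalCohomologyModule 𝔞 i M) := by
  obtain ⟨E, _, _, d, hd, hE, hH, hExt⟩ := exists_injective_complex (R := R) M
  intro i hi
  have := finite_cohomology_powTorsionComplex hd hE (𝔞 := 𝔞) (t := t)
    (fun j hj => by rw [← (hH 𝔞 j).some.annihilator_eq]; exact h j hj)
    (fun 𝔟 j => Module.Finite.equiv (hExt 𝔟 j).some) i hi
  exact Module.Finite.equiv (hH 𝔞 i).some.symm

theorem subsingleton_localCohomology_of_ext {𝔟 : Ideal R} {t : ℕ}
    (h : ∀ i < t, Subsingleton (Abelian.Ext (ModuleCat.of R (R ⧸ 𝔟)) (ModuleCat.of R M) i)) :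
    ∀ i < t, Subsingleton (LocalCohomologyModule 𝔟 i M) := by
  obtain ⟨E, _, _, d, hd, hE, hH, hExt⟩ := exists_injective_complex (R := R) M
  intro i hi
  rw [subsingleton_iff_of_cohomology (hH 𝔟 i).some]
  refine cocycles_powTorsionComplex_le hd hE (fun j hj => ?_) i hi
  exact (subsingleton_iff_of_cohomology (hExt 𝔟 j).some).mp (h j hj)

theorem subsingleton_ext_of_localCohomology {𝔟 : Ideal R} {r : ℕ}
    (h : ∀ i ≤ r, Subsingleton (LocalCohomologyModule 𝔟 i M)) :
    Subsingleton (Abelian.Ext (ModuleCat.of R (R ⧸ 𝔟)) (ModuleCat.of R M) r) := by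
  obtain ⟨E, _, _, d, hd, hE, hH, hExt⟩ := exists_injective_complex (R := R) M
  rw [subsingleton_iff_of_cohomology (hExt 𝔟 r).some]
  refine cocycles_torsionByComplex_le hd hE fun j hj => ?_
  exact (subsingleton_iff_of_cohomology (hH 𝔟 j).some).mp (h j hj)

/-- An `M`-filter regular sequence in `𝔞` of length `n` makes `H^i_𝔞(M)` an `𝔪`-torsion module
for `i < n`. -/
theorem exists_pow_smul_localCohomology_eq_zero [IsLocalRing R] [Module.Finite R M] {𝔞 : Ideal R}
    {xs : List R} (hxs : IsFilterRegularIn 𝔞 M xs) {s : R} (hs : s ∈ maximalIdeal R) {i : ℕ}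
    (hi : i < xs.length) (u : LocalCohomologyModule 𝔞 i M) : ∃ k : ℕ, s ^ k • u = 0 := by
  obtain ⟨E, _, _, d, hd, hE, hH, hExt⟩ := exists_injective_complex (R := R) M
  revert u
  rw [forall_exists_pow_smul_eq_zero_iff_of_cohomology (hH 𝔞 i).some]
  rintro z ⟨⟨n, hn⟩, hz⟩
  have hann (x : R) (hx : x ∈ 𝔞) : ∃ k : ℕ, x ^ k ∈ Module.annihilator R (R ⧸ 𝔞 ^ n) :=
    ⟨n, by rw [Ideal.annihilator_quotient]; exact Ideal.pow_mem_pow hx n⟩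
  have htors := forall_exists_pow_smul_eq_zero_iff_of_cohomology (hExt (𝔞 ^ n) i).some |>.mp
    (exists_pow_smul_ext_eq_zero_of_isFilterRegularIn hxs hann hs hi)
  obtain ⟨k, hk⟩ := htors z ⟨hn, hz⟩
  exact ⟨k, coboundaries_mono (fun j => torsionBySet_pow_le_powTorsion 𝔞 n) i hk⟩

lemma subsingleton_localCohomology_top (i : ℕ) :
    Subsingleton (LocalCohomologyModule (⊤ : Ideal R) i M) :=
  subsingleton_localCohomology_of_ext (fun j _ => subsingleton_ext_quotient_top j) i i.lt_succ_self

end Transfer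

/-! ### Artinian modules and infima of sets of degrees -/

section Aux

open IsLocalRing

lemma exists_pow_smul_eq_zero_of_isArtinian {R : Type u} [CommRing R] [IsLocalRing R] {H : Type u}
    [AddCommGroup H] [Module R H] [IsArtinian R H] {s : R} (hs : s ∈ maximalIdeal R) (u : H) :
    ∃ k : ℕ, s ^ k • u = 0 := by
  obtain ⟨k, ⟨v, hv⟩, hk⟩ := IsArtinian.exists_pow_succ_smul_dvd s
    (⟨u, Submodule.mem_span_singleton_self u⟩ : Submodule.span R {u})
  obtain ⟨r, rfl⟩ := Submodule.mem_span_singleton.mp hv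
  have hk' : s ^ (k + 1) • r • u = s ^ k • u := congrArg Subtype.val hk
  have hunit : IsUnit (1 - s * r) :=
    isUnit_one_sub_self_of_mem_nonunits _ ((maximalIdeal R).mul_mem_right r hs)
  refine ⟨k, hunit.smul_eq_zero.mp ?_⟩
  rw [sub_smul, one_smul, sub_eq_zero, ← mul_smul]
  refine hk'.symm.trans ?_
  rw [← mul_smul]
  congr 1
  ring

lemma coe_lt_biInf_iff {P : ℕ → Prop} {r : ℕ} :
    (r : ℕ∞) < ⨅ (i : ℕ) (_ : P i), (i : ℕ∞) ↔ ∀ i ≤ r, ¬ P i := by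
  rw [← ENat.add_one_le_iff (ENat.natCast_ne_top r), le_iInf₂_iff]
  refine forall_congr' fun i => ?_
  rw [imp.swap]
  norm_cast
  grind

lemma coe_eq_biInf_iff {P : ℕ → Prop} {r : ℕ} :
    (r : ℕ∞) = ⨅ (i : ℕ) (_ : P i), (i : ℕ∞) ↔ P r ∧ ∀ i < r, ¬ P i := by
  constructor
  · intro h
    have hlt : ∀ i < r, ¬ P i := fun i hi =>
      coe_lt_biInf_iff.mp (h ▸ Nat.cast_lt.mpr hi : (i : ℕ∞) < _) i le_rfl
    refine ⟨by_contra fun hr => ?_, hlt⟩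
    refine (coe_lt_biInf_iff.mpr fun i hi => ?_).ne h
    rcases hi.eq_or_lt with rfl | hi
    exacts [hr, hlt i hi]
  · rintro ⟨hr, hlt⟩
    refine le_antisymm (le_iInf₂ fun i hi => ?_) (iInf₂_le r hr)
    exact Nat.cast_le.mpr (not_lt.mp fun h => hlt i h hi)

end Aux

/-! ### Filter depth, grade and finiteness dimensions -/

section Main

open IsLocalRing

variable {R : Type u} [CommRing R] [IsNoetherianRing R] [IsLocalRing R] {𝔞 : Ideal R}
  {M : Type u} [AddCommGroup M] [Module R M]

/-- For `r = f_𝔞^𝔞(M) < f_𝔪^𝔞(M)`, the module `H^r_𝔞(M)` is not `𝔪`-torsion. -/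
theorem not_torsion_of_relFinitenessDim_lt {r : ℕ} (hr : (r : ℕ∞) = relFinitenessDim 𝔞 𝔞 M)
    (hlt : relFinitenessDim 𝔞 𝔞 M < relFinitenessDim (maximalIdeal R) 𝔞 M) :
    ¬ ∀ s ∈ maximalIdeal R, ∀ u : LocalCohomologyModule 𝔞 r M, ∃ k : ℕ, s ^ k • u = 0 := by
  intro htors
  rw [← hr] at hlt
  obtain ⟨hP, hlow⟩ := coe_eq_biInf_iff.mp hr
  have hmax := coe_lt_biInf_iff.mp hlt r le_rfl
  simp only [not_not] at hlow hmax
  have h𝔞 : 𝔞 ≤ maximalIdeal R := le_maximalIdeal fun h => hP <| by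
    subst h
    have := subsingleton_localCohomology_top (R := R) (M := M) r
    rw [Module.annihilator_eq_top_iff.mpr this, Ideal.radical_top]
  exact hP fun c hc => mem_radical_annihilator_localCohomology h𝔞 (fun i hi => hlow i hi hc)
    (hmax hc) htors

/-- For `r = grade(𝔞, M) < depth M`, the module `H^r_𝔞(M)` is not `𝔪`-torsion. -/
theorem not_torsion_of_moduleGrade_lt {r : ℕ} (hr : (r : ℕ∞) = moduleGrade 𝔞 M)
    (hlt : moduleGrade 𝔞 M < moduleDepth R M) :
    ¬ ∀ s ∈ maximalIdeal R, ∀ u : LocalCohomologyModule 𝔞 r M, ∃ k : ℕ, s ^ k • u = 0 := by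
  intro htors
  rw [← hr] at hlt
  obtain ⟨hP, hlow⟩ := coe_eq_biInf_iff.mp hr
  have hmax := coe_lt_biInf_iff.mp hlt
  simp only [nontrivial_extModule_iff, not_nontrivial_iff_subsingleton] at hP hlow hmax
  have h𝔞 : 𝔞 ≤ maximalIdeal R := le_maximalIdeal fun h => by
    subst h
    exact not_subsingleton_iff_nontrivial.mpr hP (subsingleton_ext_quotient_top r)
  have hlow' := subsingleton_localCohomology_of_ext hlow
  have hmax' := subsingleton_localCohomology_of_ext (t := r + 1)
    (fun i hi => hmax i (Nat.lt_succ_iff.mp hi)) r r.lt_succ_self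
  -- Vanishing of a module is expressed as `1 ∈ rad (Ann H)`.
  have hone (H : Type u) [AddCommGroup H] [Module R H] :
      (1 : R) ∈ (Module.annihilator R H).radical ↔ Subsingleton H := by
    rw [← Ideal.eq_top_iff_one, Ideal.radical_eq_top, Module.annihilator_eq_top_iff]
  have hzero : Subsingleton (LocalCohomologyModule 𝔞 r M) :=
    (hone _).mp <| mem_radical_annihilator_localCohomology h𝔞
      (fun i hi => (hone _).mpr (hlow' i hi)) ((hone _).mpr hmax') htors
  refine not_subsingleton_iff_nontrivial.mpr hP (subsingleton_ext_of_localCohomology fun i hi => ?_)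
  rcases hi.eq_or_lt with rfl | hi
  exacts [hzero, hlow' i hi]

variable [Module.Finite R M]

theorem filterDepth_le_finitenessDim
    (hlt : relFinitenessDim 𝔞 𝔞 M < relFinitenessDim (maximalIdeal R) 𝔞 M) :
    filterDepth 𝔞 M ≤ finitenessDim 𝔞 M := by
  refine iSup₂_le fun xs hxs => le_iInf₂ fun i hi => ?_
  by_contra! hlen
  rw [Nat.cast_lt] at hlen
  obtain ⟨r, hr⟩ := ENat.ne_top_iff_exists.mp hlt.ne_top
  obtain ⟨-, hlow⟩ := coe_eq_biInf_iff.mp hr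
  simp only [not_not] at hlow
  have hle : xs.length ≤ r := not_lt.mp fun h =>
    not_torsion_of_relFinitenessDim_lt hr hlt fun s hs =>
      exists_pow_smul_localCohomology_eq_zero hxs hs h
  exact hi (finite_localCohomology_of_le_radical_annihilator hlow i (hlen.trans_le hle))

theorem length_le_of_isFilterRegularIn (hlt : moduleGrade 𝔞 M < moduleDepth R M) {xs : List R}
    (hxs : IsFilterRegularIn 𝔞 M xs) : (xs.length : ℕ∞) ≤ moduleGrade 𝔞 M := by
  obtain ⟨r, hr⟩ := ENat.ne_top_iff_exists.mp hlt.ne_top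
  rw [← hr, Nat.cast_le]
  exact not_lt.mp fun h => not_torsion_of_moduleGrade_lt hr hlt fun s hs =>
    exists_pow_smul_localCohomology_eq_zero hxs hs h

theorem exists_isFilterRegularIn_append_of_length_lt (hlt : moduleGrade 𝔞 M < moduleDepth R M)
    {xs : List R} (hxs : IsFilterRegularIn 𝔞 M xs) (hlen : (xs.length : ℕ∞) < moduleGrade 𝔞 M) :
    ∃ y, IsFilterRegularIn 𝔞 M (xs ++ [y]) := by
  have h𝔞 := coe_lt_biInf_iff.mp hlen
  have h𝔪 := coe_lt_biInf_iff.mp (hlen.trans hlt)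
  simp only [nontrivial_extModule_iff, not_nontrivial_iff_subsingleton] at h𝔞 h𝔪
  exact exists_isFilterRegularIn_append hxs h𝔞 h𝔪

theorem length_eq_of_isMaximalFilterRegularIn (hlt : moduleGrade 𝔞 M < moduleDepth R M)
    {xs : List R} (hxs : IsMaximalFilterRegularIn 𝔞 M xs) :
    (xs.length : ℕ∞) = moduleGrade 𝔞 M :=
  (length_le_of_isFilterRegularIn hlt hxs.1).antisymm <| not_lt.mp fun h =>
    (exists_isFilterRegularIn_append_of_length_lt hlt hxs.1 h).elim hxs.2

theorem moduleGrade_eq_filterDepth (hlt : moduleGrade 𝔞 M < moduleDepth R M) :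
    moduleGrade 𝔞 M = filterDepth 𝔞 M := by
  refine le_antisymm ?_ (iSup₂_le fun xs hxs => length_le_of_isFilterRegularIn hlt hxs)
  obtain ⟨r, hr⟩ := ENat.ne_top_iff_exists.mp hlt.ne_top
  have hex (n : ℕ) (hn : n ≤ r) : ∃ xs, IsFilterRegularIn 𝔞 M xs ∧ xs.length = n := by
    induction n with
    | zero => exact ⟨[], isFilterRegularIn_nil 𝔞 M, rfl⟩
    | succ n ih =>
      obtain ⟨xs, hxs, rfl⟩ := ih (by omega)
      obtain ⟨y, hy⟩ := exists_isFilterRegularIn_append_of_length_lt hlt hxs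
        (by rw [← hr, Nat.cast_lt]; exact hn)
      exact ⟨_, hy, by simp⟩
  obtain ⟨xs, hxs, hlen⟩ := hex r le_rfl
  rw [← hr, ← hlen]
  exact le_iSup₂_of_le xs hxs le_rfl

end Main

theorem theorem2p5 {R : Type u} [CommRing R] [IsNoetherianRing R] [IsLocalRing R]
    (𝔞 : Ideal R) (M : Type u) [AddCommGroup M] [Module R M] :
    (relFinitenessDim 𝔞 𝔞 M < relFinitenessDim (IsLocalRing.maximalIdeal R) 𝔞 M →
      (∀ r : ℕ, (r : ℕ∞) = relFinitenessDim 𝔞 𝔞 M →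
        ¬ IsArtinian R (LocalCohomologyModule 𝔞 r M)) ∧
      (Module.Finite R M → filterDepth 𝔞 M ≤ finitenessDim 𝔞 M)) ∧
    (moduleGrade 𝔞 M < moduleDepth R M →
      (∀ r : ℕ, (r : ℕ∞) = moduleGrade 𝔞 M →
        ¬ IsArtinian R (LocalCohomologyModule 𝔞 r M)) ∧
      (Module.Finite R M → moduleGrade 𝔞 M = filterDepth 𝔞 M ∧
        ∀ xs : List R, IsMaximalFilterRegularIn 𝔞 M xs →
          (xs.length : ℕ∞) = moduleGrade 𝔞 M)) :=
  ⟨fun hlt => ⟨fun _ hr _ => not_torsion_of_relFinitenessDim_lt hr hlt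
      fun _ hs u => exists_pow_smul_eq_zero_of_isArtinian hs u,
    fun _ => filterDepth_le_finitenessDim hlt⟩,
  fun hlt => ⟨fun _ hr _ => not_torsion_of_moduleGrade_lt hr hlt
      fun _ hs u => exists_pow_smul_eq_zero_of_isArtinian hs u,
    fun _ => ⟨moduleGrade_eq_filterDepth hlt,
      fun _ => length_eq_of_isMaximalFilterRegularIn hlt⟩⟩⟩
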